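/- Let $X$ be a finite set of clocks. Atomic constraints are $x \triangleleft c$, $c \triangleleft x$ ($c\in\mathbb N$, non-diagonal) and $x-y\triangleleft d$ ($d\in\mathbb Z$, diagonal), with $x,y\in X$ and $\triangleleft\in\{<,\le\}$; a guard is a finite conjunction of atomic constraints, identified with the set of its conjuncts. A valuation is a map $v:X\to\mathbb R_{\ge0}$; $(v+\delta)(x)=v(x)+\delta$, and $[R]v$ sets the clocks of $R\subseteq X$ to $0$. Let $\mathcal A=(Q,X,q_0,T,F)$ be a timed automaton with finitely many states and transitions $t=(q,g,R,q')\in T$. A run is a finite sequence of steps $(q,v)\to(q',[R](v+\delta))$ with $\delta\ge0$, $(q,g,R,q')\in T$ and $v+\delta\models g$, starting from $(q_0,\mathbf 0)$; it is accepting if its last state lies in $F$. State based guards. For an atomic constraint $\varphi$ and $R\subseteq X$ let $wp(\varphi,R)$ be: for $\varphi$ of the form $x\triangleleft c$ or $c\triangleleft x$, empty if $x\in R$ and $\{\varphi\}$ otherwise; for $\varphi$ of the form $x-y\triangleleft c$, equal to $\{\varphi\}$ if $x,y\notin R$, to $\{x\triangleleft c\}$ if $y\in R$, $x\notin R$, $c\ge0$,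 to $\{-c\triangleleft y\}$ if $x\in R$, $y\notin R$, $-c\ge0$, and empty otherwise. The family $(\mathcal G(q))_{q\in Q}$ is the least solution of $$\mathcal G(q)=\bigcup_{(q,g,R,q_1)\in T}\Big(g\cup\bigcup_{\varphi\in\mathcal G(q_1)}wp(\varphi,R)\Big).$$ The relation $\preceq^{LU}_{\mathcal A}$. For a set of constraints $G$ let $L_G(x)$ be the maximum of the $c$ with $(c\triangleleft x)\in G$, and $U_G(x)$ the maximum of the $c$ with $(x\triangleleft c)\in G$ ($-\infty$ if there are none). Put $(q,v)\preceq^{LU}_{\mathcal A}(q,v')$ if, with $G=\mathcal G(q)$: for every clock $x$, $v'(x)<v(x)$ implies $L_G(x)<v'(x)$, and $v(x)<v'(x)$ implies $U_G(x)<v(x)$; and every diagonal constraint of $G$ satisfied by $v$ is satisfied by $v'$. For sets of valuations, $(q,Z)\preceq^{LU}_{\mathcal A}(q,Z')$ if for each $v\in Z$ there is $v'\in Z'$ with $(q,v)\preceq^{LU}_{\mathcal A}(q,v')$. Enumeration. A zone is the set of valuations satisfying a finite conjunction of constraints $x\triangleleft c$, $c\triangleleft x$, $x-y\triangleleft c$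 with $c\in\mathbb Z$. For $t=(q,g,R,q_1)$, the $t$-successor of $(q,Z)$ is $(q_1,Z_1)$ with $Z_1=\{[R]v+\delta : v\in Z,\ v\models g,\ \delta\ge0\}$. The enumeration answers "accepting run" at once if $q_0\in F$. Otherwise it keeps two lists of nodes, Passed (initially empty) and Waiting (initially containing just $(q_0,\{\mathbf 0+\delta:\delta\ge0\})$), and repeats: if Waiting is empty, answer "no accepting run"; else move some node $(q,Z)$ from Waiting to Passed and, for each transition $t$ leaving $q$ in some order, compute the $t$-successor $(q_1,Z_1)$. If $Z_1\neq\emptyset$, then: if $q_1\in F$, answer "accepting run"; else, if some $(q_1,Z_1')$ in Passed or Waiting satisfies $(q_1,Z_1)\preceq^{LU}_{\mathcal A}(q_1,Z_1')$, ignore $(q_1,Z_1)$; else add it to Waiting. Theorem. For every timed automaton $\mathcal A$ (possibly with diagonal constraints): 1. The sets $\mathcal G(q)$ can be computed by a terminating fixed point computation: let $\mathcal G_0(q)=\bigcup_{(q,g,R,q_1)\in T}g$ and $\mathcal G_{n+1}(q)=\mathcal G_n(q)\cup\bigcup_{(q,g,R,q_1)\in T}\bigcup_{\varphi\in\mathcal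 G_n(q_1)}wp(\varphi,R)$, which are finite sets. There is an $n$ with $\mathcal G_{n+1}=\mathcal G_n$, and for every such $n$ one has $\mathcal G_n(q)=\mathcal G(q)$ for all $q\in Q$. 2. The enumeration is a sound, complete and terminating procedure for reachability, whatever choices of nodes and orders of transitions it makes: all nodes that it stores are zones; no execution is infinite, and an execution stops only with an answer; if it answers "accepting run" then $\mathcal A$ has an accepting run; if it answers "no accepting run" then $\mathcal A$ has none. -/

import Mathlib

open scoped NNReal

namespace TimedAutomata

/-- The comparison symbols `<` and `≤`. -/
inductive Cmp where
  | lt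
  | le
  deriving DecidableEq

/-- The relation on the reals denoted by a comparison symbol. -/
def Cmp.Rel : Cmp → ℝ → ℝ → Prop
  | .lt, a, b => a < b
  | .le, a, b => a ≤ b

/-- Atomic constraints over the clocks `X`:
`upper x s c` is `x ◁ c`, `lower s c x` is `c ◁ x` (both non-diagonal, `c ∈ ℕ`), and
`diag x y s d` is the diagonal constraint `x - y ◁ d` (`d ∈ ℤ`), where `◁` is `s`. -/
inductive Constraint (X : Type*) where
  | upper (x : X) (s : Cmp) (c : ℕ)
  | lower (s : Cmp) (c : ℕ) (x : X)
  | diag (x y : X) (s : Cmp) (d : ℤ)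
  deriving DecidableEq

/-- Clock valuations. -/
abbrev Valuation (X : Type*) := X → ℝ≥0

section Valuations

variable {X : Type*}

/-- `v ⊨ φ` for an atomic constraint `φ`. -/
def Constraint.Sat (v : Valuation X) : Constraint X → Prop
  | .upper x s c => s.Rel (v x) c
  | .lower s c x => s.Rel c (v x)
  | .diag x y s d => s.Rel ((v x : ℝ) - v y) d

/-- Being a diagonal constraint. -/
def Constraint.IsDiag : Constraint X → Prop
  | .diag _ _ _ _ => True
  | _ => False

/-- A guard is a finite conjunction of atomic constraints, given by the finite set of its conjuncts
(the empty conjunction is the guard `true`). -/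
abbrev Guard (X : Type*) := Finset (Constraint X)

/-- `v ⊨ g` for a guard `g`. -/
def Guard.Sat (v : Valuation X) (g : Guard X) : Prop := ∀ φ ∈ g, φ.Sat v

/-- `v + δ`. -/
def Valuation.delay (v : Valuation X) (δ : ℝ≥0) : Valuation X := fun x => v x + δ

/-- `[R]v`: the clocks in `R` are set to `0`, the other ones keep their values. -/
def Valuation.reset [DecidableEq X] (R : Finset X) (v : Valuation X) : Valuation X :=
  fun x => if x ∈ R then 0 else v x

end Valuations

/-- A transition `(q, g, R, q')`. -/
structure Transition (Q X : Type*) where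
  src : Q
  guard : Guard X
  reset : Finset X
  tgt : Q

/-- A timed automaton with states `Q`, clocks `X` (both will be finite types), initial state,
finite set of transitions, and accepting states. Guards may use diagonal constraints. -/
structure Automaton (Q X : Type*) where
  init : Q
  trans : Finset (Transition Q X)
  accept : Finset Q

section Semantics

variable {Q X : Type*} [DecidableEq X]

/-- The action transition `(q, v) →ᵗ (q', v')` between configurations. -/
def Transition.Action (t : Transition Q X) (c c' : Q × Valuation X) : Prop :=
  t.src = c.1 ∧ t.guard.Sat c.2 ∧ c' = (t.tgt, c.2.reset t.reset)

/-- A delay followed by an action transition of the automaton. -/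
def Automaton.DelayAction (A : Automaton Q X) (c c' : Q × Valuation X) : Prop :=
  ∃ δ : ℝ≥0, ∃ t ∈ A.trans, t.Action (c.1, c.2.delay δ) c'

/-- There is a run, i.e. a finite sequence of delay-action steps from the initial state and the
valuation `0`, that ends in an accepting state. -/
def Automaton.HasAcceptingRun (A : Automaton Q X) : Prop :=
  ∃ c : Q × Valuation X,
    Relation.ReflTransGen A.DelayAction (A.init, fun _ => 0) c ∧ c.1 ∈ A.accept

end Semantics

section Zones

variable {Q X : Type*}

/-- Constraints that define zones: `x ◁ c`, `c ◁ x` and `x - y ◁ c` with `c ∈ ℤ`. -/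
inductive ZoneConstraint (X : Type*) where
  | upper (x : X) (s : Cmp) (c : ℤ)
  | lower (s : Cmp) (c : ℤ) (x : X)
  | diag (x y : X) (s : Cmp) (c : ℤ)

/-- `v ⊨ φ` for a zone constraint `φ`. -/
def ZoneConstraint.Sat (v : Valuation X) : ZoneConstraint X → Prop
  | .upper x s c => s.Rel (v x) c
  | .lower s c x => s.Rel c (v x)
  | .diag x y s c => s.Rel ((v x : ℝ) - v y) c

/-- A zone is the set of valuations that satisfy a finite conjunction of zone constraints. -/
def IsZone (Z : Set (Valuation X)) : Prop :=
  ∃ C : List (ZoneConstraint X), Z = {v | ∀ φ ∈ C, φ.Sat v}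

/-- Time elapse `{v + δ | v ∈ Z, δ ≥ 0}`. -/
def elapse (Z : Set (Valuation X)) : Set (Valuation X) :=
  {w | ∃ v ∈ Z, ∃ δ : ℝ≥0, w = v.delay δ}

/-- The intersection `Z ∧ g` of `Z` with a guard `g`. -/
def meetGuard (Z : Set (Valuation X)) (g : Guard X) : Set (Valuation X) :=
  {v | v ∈ Z ∧ g.Sat v}

/-- `[R]Z = {[R]v | v ∈ Z}`. -/
def resetSet [DecidableEq X] (R : Finset X) (Z : Set (Valuation X)) : Set (Valuation X) :=
  {w | ∃ v ∈ Z, w = v.reset R}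

/-- The zone `Z₁` with `(q, Z) ⇒ᵗ (q₁, Z₁)` in the zone graph, for `t = (q, g, R, q₁)`:
the time elapse of `[R](Z ∧ g)`. -/
def Transition.post [DecidableEq X] (t : Transition Q X) (Z : Set (Valuation X)) :
    Set (Valuation X) :=
  elapse (resetSet t.reset (meetGuard Z t.guard))

/-- The initial zone `{0 + δ | δ ≥ 0}`. -/
def initialZone (X : Type*) : Set (Valuation X) := elapse {fun _ => 0}

/-- Nodes `(q, Z)` of the zone graph. -/
abbrev Node (Q X : Type*) := Q × Set (Valuation X)

end Zones

section StateGuards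

variable {Q X : Type*} [DecidableEq X]

/-- The weakest precondition `wp(⊑_φ, R)` over the reset of `R`, for an atomic constraint `φ`. -/
def Constraint.wp (R : Finset X) : Constraint X → Finset (Constraint X)
  | .upper x s c => if x ∈ R then ∅ else {.upper x s c}
  | .lower s c x => if x ∈ R then ∅ else {.lower s c x}
  | .diag x y s d =>
      if x ∉ R ∧ y ∉ R then {.diag x y s d}
      else if y ∈ R ∧ x ∉ R ∧ 0 ≤ d then {.upper x s d.toNat}
      else if x ∈ R ∧ y ∉ R ∧ 0 ≤ -d then {.lower s (-d).toNat y}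
      else ∅

/-- The right-hand side of the equations
`G(q) = ⋃_{(q, g, R, q₁) ∈ T} (g ∪ wp(⊑_{G(q₁)}, R))`, where a guard `g` contributes its conjuncts,
as a monotone operator on families of sets of constraints. -/
def Automaton.guardOperator (A : Automaton Q X) :
    (Q → Set (Constraint X)) →o (Q → Set (Constraint X)) where
  toFun G q :=
    {φ | ∃ t ∈ A.trans, t.src = q ∧ (φ ∈ t.guard ∨ ∃ ψ ∈ G t.tgt, φ ∈ ψ.wp t.reset)}
  monotone' := by
    rintro G G' h q φ ⟨t, ht, hq, hφ⟩
    refine ⟨t, ht, hq, hφ.imp_right ?_⟩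
    rintro ⟨ψ, hψ, hw⟩
    exact ⟨ψ, h t.tgt hψ, hw⟩

/-- The state based guards `{G(q)}_q`: the least solution of the equations. -/
def Automaton.stateGuards (A : Automaton Q X) : Q → Set (Constraint X) :=
  A.guardOperator.lfp

/-- The fixed point computation: it starts with the guards of the transitions that leave `q`, and
each round adds the weakest preconditions of the constraints found so far at the target states. -/
def Automaton.guardRound [DecidableEq Q] (A : Automaton Q X) : ℕ → Q → Finset (Constraint X)
  | 0, q => (A.trans.filter fun t => t.src = q).biUnion fun t => t.guard
  | n + 1, q => A.guardRound n q ∪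
      (A.trans.filter fun t => t.src = q).biUnion fun t =>
        (A.guardRound n t.tgt).biUnion fun ψ => ψ.wp t.reset

end StateGuards

section Simulation

variable {Q X : Type*}

/-- `L_G(x)`: the maximal `c` with `c ◁ x` in `G`, and `-∞` if there is none. -/
noncomputable def lowerBound (G : Set (Constraint X)) (x : X) : EReal :=
  sSup {r | ∃ (s : Cmp) (c : ℕ), Constraint.lower s c x ∈ G ∧ r = ((c : ℝ) : EReal)}

/-- `U_G(x)`: the maximal `c` with `x ◁ c` in `G`, and `-∞` if there is none. -/
noncomputable def upperBound (G : Set (Constraint X)) (x : X) : EReal :=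
  sSup {r | ∃ (s : Cmp) (c : ℕ), Constraint.upper x s c ∈ G ∧ r = ((c : ℝ) : EReal)}

/-- The relation `v ≼_LU v'` for bounds functions `L` and `U`. -/
def LUSim (L U : X → EReal) (v v' : Valuation X) : Prop :=
  ∀ x, (v' x < v x → L x < (((v' x : ℝ≥0) : ℝ) : EReal)) ∧
    (v x < v' x → U x < (((v x : ℝ≥0) : ℝ) : EReal))

/-- The relation `v ⊑_G^LU v'`: `v ≼_{LU(G)} v'`, and `v'` satisfies each diagonal constraint of `G`
that `v` satisfies. -/
def GuardLUSim (G : Set (Constraint X)) (v v' : Valuation X) : Prop :=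
  LUSim (lowerBound G) (upperBound G) v v' ∧ ∀ φ ∈ G, φ.IsDiag → φ.Sat v → φ.Sat v'

/-- The relation `≼_A^LU` on configurations. -/
def Automaton.ConfigSim [DecidableEq X] (A : Automaton Q X) (c c' : Q × Valuation X) : Prop :=
  c.1 = c'.1 ∧ GuardLUSim (A.stateGuards c.1) c.2 c'.2

/-- Its extension to nodes: each configuration in `(q, Z)` is simulated by one in `(q', Z')`
(and `q = q'`). -/
def Automaton.NodeSim [DecidableEq X] (A : Automaton Q X) (m m' : Node Q X) : Prop :=
  m.1 = m'.1 ∧ ∀ v ∈ m.2, ∃ v' ∈ m'.2, A.ConfigSim (m.1, v) (m'.1, v')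

end Simulation

section Enumeration

variable {Q X : Type*} [DecidableEq X]

/-- The states of the zone graph enumeration.
`search P W`: about to pick a node, with lists Passed `P` and Waiting `W`;
`expand P W m ts`: the node `m` is being expanded and the transitions `ts` remain to be treated;
`answer b`: the enumeration has returned "there is an accepting run" (`b = true`), or "there is no
accepting run" (`b = false`). -/
inductive SearchState (Q X : Type*) where
  | search (P W : List (Node Q X))
  | expand (P W : List (Node Q X)) (m : Node Q X) (ts : List (Transition Q X))
  | answer (b : Bool)

/-- One step of the zone graph enumeration that prunes with `≼_A^LU`. The choice of the node that is
picked from Waiting, and the order of the transitions leaving it, are arbitrary. -/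
inductive Automaton.SearchStep (A : Automaton Q X) : SearchState Q X → SearchState Q X → Prop where
  | finish (P) : A.SearchStep (.search P []) (.answer false)
  | pick (P W₁ W₂ m ts) (hnd : ts.Nodup) (hts : ∀ t, t ∈ ts ↔ t ∈ A.trans ∧ t.src = m.1) :
      A.SearchStep (.search P (W₁ ++ m :: W₂)) (.expand (m :: P) (W₁ ++ W₂) m ts)
  | done (P W m) : A.SearchStep (.expand P W m []) (.search P W)
  | empty (P W m t ts) (he : t.post m.2 = ∅) :
      A.SearchStep (.expand P W m (t :: ts)) (.expand P W m ts)
  | found (P W m t ts) (hne : (t.post m.2).Nonempty) (hacc : t.tgt ∈ A.accept) :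
      A.SearchStep (.expand P W m (t :: ts)) (.answer true)
  | prune (P W m t ts) (hne : (t.post m.2).Nonempty) (hacc : t.tgt ∉ A.accept)
      (hsim : ∃ m' ∈ P ++ W, A.NodeSim (t.tgt, t.post m.2) m') :
      A.SearchStep (.expand P W m (t :: ts)) (.expand P W m ts)
  | add (P W m t ts) (hne : (t.post m.2).Nonempty) (hacc : t.tgt ∉ A.accept)
      (hsim : ¬ ∃ m' ∈ P ++ W, A.NodeSim (t.tgt, t.post m.2) m') :
      A.SearchStep (.expand P W m (t :: ts)) (.expand P ((t.tgt, t.post m.2) :: W) m ts)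

/-- The enumeration starts with the initial node in Waiting; if the initial state is accepting, it
answers at once. -/
def Automaton.searchStart [DecidableEq Q] (A : Automaton Q X) : SearchState Q X :=
  if A.init ∈ A.accept then .answer true else .search [] [(A.init, initialZone X)]

/-- The nodes that a state of the enumeration stores. -/
def SearchState.nodes : SearchState Q X → List (Node Q X)
  | .search P W => P ++ W
  | .expand P W _ _ => P ++ W
  | .answer _ => []

/-- The states that some execution of the enumeration reaches. -/
def Automaton.SearchReaches [DecidableEq Q] (A : Automaton Q X) (s : SearchState Q X) : Prop :=
  Relation.ReflTransGen A.SearchStep A.searchStart s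

end Enumeration

end TimedAutomata

/-! Correctness rests on `GuardLUSim` being a simulation when it is taken over the state based
guards. A simulating valuation satisfies every constraint of the set that the simulated one
satisfies (`GuardLUSim.sat`), and the relation survives delays (`GuardLUSim.delay`). It also
survives resets, because the sets are closed under weakest preconditions (`GuardLUSim.reset`). So if
each nonempty successor of a stored node is simulated by a stored node, every run can be followed
through the stored nodes, whose states are not accepting (`not_hasAcceptingRun_of_covered`).
Conversely, each stored valuation is a delay of a reachable one, which gives soundness.

Termination requires finite information that decides pruning. Two symmetries supply it. First, if
the clocks leave a large enough gap, those above it can be lowered by `1` without changing any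
relevant comparison, so each valuation is equivalent in both directions to a bounded one
(`exists_bounded_representative`). Second, an increasing map of the line that fixes `0` and commutes
with integer translations preserves every zone, whatever its constants, as well as the simulation
(`IsDiffZone.retime_mem`, `GuardLUSim.retime`). Such maps act transitively on the bounded valuations
with the same integral parts and order of fractional parts (`exists_retiming_of_code_eq`). Hence the
set of codes of bounded valuations simulated by a zone determines what the zone simulates
(`exists_guardLUSim_of_simCodes_subset`). A new node with an old code would be pruned, so only
finitely many nodes are added.

That successors are zones is Fourier–Motzkin elimination (`exists_eliminate`). The fixed point
computation stops because weakest preconditions never enlarge constants. -/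

namespace TimedAutomata

/-! ### Computation of the state based guards -/

section FixedPoint

variable {Q X : Type*} [DecidableEq X]

/-- The constant of an atomic constraint is at most `M` in absolute value. -/
def Constraint.BoundedBy (M : ℕ) : Constraint X → Prop
  | .upper _ _ c => c ≤ M
  | .lower _ c _ => c ≤ M
  | .diag _ _ _ d => d.natAbs ≤ M

omit [DecidableEq X] in
theorem Constraint.BoundedBy.mono {M N : ℕ} (h : M ≤ N) {φ : Constraint X}
    (hφ : φ.BoundedBy M) : φ.BoundedBy N := by
  cases φ <;> exact le_trans hφ h

omit [DecidableEq X] in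
theorem exists_boundedBy_of_finite {G : Set (Constraint X)} (hG : G.Finite) :
    ∃ M, ∀ φ ∈ G, φ.BoundedBy M := by
  induction G, hG using Set.Finite.induction_on with
  | empty => exact ⟨0, by simp⟩
  | @insert φ G _ _ ih =>
    obtain ⟨M, hM⟩ := ih
    obtain ⟨N, hN⟩ : ∃ N, φ.BoundedBy N := by cases φ <;> exact ⟨_, le_rfl⟩
    refine ⟨max M N, ?_⟩
    rintro ψ (rfl | hψ)
    · exact hN.mono (le_max_right _ _)
    · exact (hM ψ hψ).mono (le_max_left _ _)

omit [DecidableEq X] in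
theorem finite_setOf_boundedBy [Finite X] (M : ℕ) :
    {φ : Constraint X | φ.BoundedBy M}.Finite := by
  have hcmp : Finite Cmp :=
    Finite.of_surjective (fun b : Bool => if b then Cmp.lt else Cmp.le)
      (by rintro (_ | _); exacts [⟨true, rfl⟩, ⟨false, rfl⟩])
  have h1 := Set.toFinite (Set.range fun p : X × Cmp × Fin (M + 1) =>
    Constraint.upper p.1 p.2.1 p.2.2.1)
  have h2 := Set.toFinite (Set.range fun p : X × Cmp × Fin (M + 1) =>
    Constraint.lower p.2.1 p.2.2.1 p.1)
  have h3 := Set.toFinite (Set.range fun p : X × X × Cmp × Set.Icc (-(M : ℤ)) M =>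
    Constraint.diag p.1 p.2.1 p.2.2.1 p.2.2.2.1)
  refine ((h1.union h2).union h3).subset ?_
  rintro (⟨x, s, c⟩ | ⟨s, c, x⟩ | ⟨x, y, s, d⟩) h
  · exact .inl (.inl ⟨(x, s, ⟨c, Nat.lt_succ_of_le h⟩), rfl⟩)
  · exact .inl (.inr ⟨(x, s, ⟨c, Nat.lt_succ_of_le h⟩), rfl⟩)
  · have h' : d.natAbs ≤ M := h
    exact .inr ⟨(x, y, s, ⟨d, by constructor <;> omega⟩), rfl⟩

/-- A weakest precondition keeps the constant or changes its sign, so all rounds stay within one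
finite set of constraints. -/
theorem Constraint.BoundedBy.wp {M : ℕ} {φ ψ : Constraint X} {R : Finset X}
    (h : ψ.BoundedBy M) (hφ : φ ∈ ψ.wp R) : φ.BoundedBy M := by
  cases ψ with
  | upper x s c =>
    simp only [Constraint.wp] at hφ
    split_ifs at hφ <;> simp_all
  | lower s c x =>
    simp only [Constraint.wp] at hφ
    split_ifs at hφ <;> simp_all
  | diag x y s d =>
    have h' : d.natAbs ≤ M := h
    simp only [Constraint.wp] at hφ
    split_ifs at hφ
    · simp_all
    · rw [Finset.mem_singleton.1 hφ]
      simp only [Constraint.BoundedBy]; omega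
    · rw [Finset.mem_singleton.1 hφ]
      simp only [Constraint.BoundedBy]; omega
    · simp at hφ

variable [DecidableEq Q] (A : Automaton Q X)

theorem mem_guardRound_zero {q : Q} {φ : Constraint X} :
    φ ∈ A.guardRound 0 q ↔ ∃ t ∈ A.trans, t.src = q ∧ φ ∈ t.guard := by
  simp [Automaton.guardRound, and_assoc]

theorem mem_guardRound_succ {n : ℕ} {q : Q} {φ : Constraint X} :
    φ ∈ A.guardRound (n + 1) q ↔ φ ∈ A.guardRound n q ∨
      ∃ t ∈ A.trans, t.src = q ∧ ∃ ψ ∈ A.guardRound n t.tgt, φ ∈ ψ.wp t.reset := by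
  simp [Automaton.guardRound, and_assoc]

theorem guardRound_monotone : Monotone A.guardRound :=
  monotone_nat_of_le_succ fun _ _ _ h => (mem_guardRound_succ A).2 (.inl h)

/-- The rounds increase inside a finite set of families, so two rounds `m < n` coincide, and round
`m + 1` is squeezed between them. -/
theorem exists_guardRound_stable [Finite Q] [Finite X] :
    ∃ n, A.guardRound (n + 1) = A.guardRound n := by
  obtain ⟨M, hM⟩ := exists_boundedBy_of_finite
    (A.trans.biUnion fun t => t.guard).finite_toSet
  have hbound : ∀ n q, ∀ φ ∈ A.guardRound n q, φ.BoundedBy M := by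
    intro n
    induction n with
    | zero =>
      intro q φ hφ
      obtain ⟨t, ht, -, hg⟩ := (mem_guardRound_zero A).1 hφ
      exact hM φ (by simpa using ⟨t, ht, hg⟩)
    | succ n ih =>
      intro q φ hφ
      rcases (mem_guardRound_succ A).1 hφ with h | ⟨t, -, -, ψ, hψ, hw⟩
      · exact ih q φ h
      · exact (ih _ ψ hψ).wp hw
  set U := (finite_setOf_boundedBy (X := X) M).toFinset
  have hfin : {G : Q → Finset (Constraint X) | ∀ q, G q ∈ (U.powerset : Set _)}.Finite :=
    Set.Finite.pi' fun _ => U.powerset.finite_toSet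
  have hmem : ∀ n, A.guardRound n ∈
      {G : Q → Finset (Constraint X) | ∀ q, G q ∈ (U.powerset : Set _)} := by
    intro n q
    simp only [Finset.coe_powerset, Set.mem_preimage, Set.mem_powerset_iff, Finset.coe_subset]
    intro φ hφ
    simpa [U] using hbound n q φ hφ
  obtain ⟨m, n, hmn, heq⟩ := hfin.exists_lt_map_eq_of_forall_mem hmem
  refine ⟨m, le_antisymm ?_ (guardRound_monotone A m.le_succ)⟩
  rw [heq]
  exact guardRound_monotone A hmn

theorem guardRound_le_stateGuards (n : ℕ) (q : Q) :
    (A.guardRound n q : Set (Constraint X)) ⊆ A.stateGuards q := by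
  have hfix : A.guardOperator A.stateGuards = A.stateGuards := A.guardOperator.map_lfp
  induction n generalizing q with
  | zero =>
    intro φ hφ
    obtain ⟨t, ht, hq, hg⟩ := (mem_guardRound_zero A).1 hφ
    rw [← hfix]
    exact ⟨t, ht, hq, .inl hg⟩
  | succ n ih =>
    intro φ hφ
    rcases (mem_guardRound_succ A).1 hφ with h | ⟨t, ht, hq, ψ, hψ, hw⟩
    · exact ih q h
    · rw [← hfix]
      exact ⟨t, ht, hq, .inr ⟨ψ, ih _ hψ, hw⟩⟩

theorem guardRound_eq_stateGuards {n : ℕ} (h : A.guardRound (n + 1) = A.guardRound n) (q : Q) :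
    (A.guardRound n q : Set (Constraint X)) = A.stateGuards q := by
  refine (guardRound_le_stateGuards A n q).antisymm ?_
  -- A stable round is a pre-fixed point of the operator, so it lies above the least fixed point.
  have hle : A.stateGuards ≤ fun q => (A.guardRound n q : Set (Constraint X)) := by
    refine A.guardOperator.lfp_le ?_
    rintro q φ ⟨t, ht, hq, hg | ⟨ψ, hψ, hw⟩⟩
    · exact guardRound_monotone A n.zero_le q ((mem_guardRound_zero A).2 ⟨t, ht, hq, hg⟩)
    · have := (mem_guardRound_succ A).2 (.inr ⟨t, ht, hq, ψ, hψ, hw⟩)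
      rwa [h] at this
  exact hle q

theorem stateGuards_finite [Finite Q] [Finite X] (q : Q) : (A.stateGuards q).Finite := by
  obtain ⟨n, hn⟩ := exists_guardRound_stable A
  rw [← guardRound_eq_stateGuards A hn q]
  exact Finset.finite_toSet _

omit [DecidableEq Q] in
theorem guard_subset_stateGuards {t : Transition Q X} (ht : t ∈ A.trans) {φ : Constraint X}
    (hφ : φ ∈ t.guard) : φ ∈ A.stateGuards t.src := by
  have hfix : A.guardOperator A.stateGuards = A.stateGuards := A.guardOperator.map_lfp
  rw [← hfix]
  exact ⟨t, ht, rfl, .inl hφ⟩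

omit [DecidableEq Q] in
theorem wp_subset_stateGuards {t : Transition Q X} (ht : t ∈ A.trans) {φ ψ : Constraint X}
    (hψ : ψ ∈ A.stateGuards t.tgt) (hφ : φ ∈ ψ.wp t.reset) : φ ∈ A.stateGuards t.src := by
  have hfix : A.guardOperator A.stateGuards = A.stateGuards := A.guardOperator.map_lfp
  rw [← hfix]
  exact ⟨t, ht, rfl, .inr ⟨ψ, hψ, hφ⟩⟩

end FixedPoint

/-! ### Difference constraints and elimination of variables -/

section Zones

theorem coe_le_zero_iff {r : ℝ≥0} : (r : ℝ) ≤ 0 ↔ r = 0 := by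
  rw [← NNReal.coe_zero, NNReal.coe_le_coe, nonpos_iff_eq_zero]

/-- A difference constraint `a - b ◁ c` over the variables `Y`. -/
structure Diff (Y : Type*) where
  a : Y
  b : Y
  s : Cmp
  c : ℤ

/-- Satisfaction of a difference constraint by real values of the variables. -/
def Diff.Sat {Y : Type*} (u : Y → ℝ) (φ : Diff Y) : Prop := φ.s.Rel (u φ.a - u φ.b) φ.c

/-- Renaming of the variables of a difference constraint. -/
def Diff.map {Y Y' : Type*} (f : Y → Y') (φ : Diff Y) : Diff Y' := ⟨f φ.a, f φ.b, φ.s, φ.c⟩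

theorem Diff.sat_map {Y Y' : Type*} (f : Y → Y') (u : Y' → ℝ) (φ : Diff Y) :
    (φ.map f).Sat u ↔ φ.Sat (u ∘ f) := Iff.rfl

/-- The stricter of two comparison symbols. -/
def Cmp.strictest : Cmp → Cmp → Cmp
  | .le, .le => .le
  | _, _ => .lt

theorem Cmp.Rel.le {s : Cmp} {a b : ℝ} (h : s.Rel a b) : a ≤ b := by
  cases s
  exacts [le_of_lt h, h]

theorem Cmp.rel_of_lt {s : Cmp} {a b : ℝ} (h : a < b) : s.Rel a b := by
  cases s
  exacts [h, le_of_lt h]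

theorem Cmp.Rel.strictest_trans {s s' : Cmp} {a b c : ℝ} (h : s.Rel a b) (h' : s'.Rel b c) :
    (s.strictest s').Rel a c := by
  cases s <;> cases s' <;> simp only [Cmp.Rel, Cmp.strictest] at * <;> linarith

theorem Cmp.rel_iff_of_sub_eq {s : Cmp} {a b c d : ℝ} (h : b - a = d - c) :
    s.Rel a b ↔ s.Rel c d := by
  cases s <;> simp only [Cmp.Rel] <;> constructor <;> intro h' <;> linarith

theorem Cmp.rel_of_strictest_self {s s' : Cmp} {a : ℝ} (h : (s.strictest s').Rel a a) :
    s.Rel a a ∧ s'.Rel a a := by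
  cases s <;> cases s' <;> simp_all [Cmp.Rel, Cmp.strictest]

/-- Finitely many lower bounds and upper bounds have a common solution as soon as each lower bound
is compatible with each upper bound. -/
theorem exists_between_bounds (L U : List (Cmp × ℝ))
    (h : ∀ l ∈ L, ∀ u ∈ U, (l.1.strictest u.1).Rel l.2 u.2) :
    ∃ r : ℝ, (∀ l ∈ L, l.1.Rel l.2 r) ∧ ∀ u ∈ U, u.1.Rel r u.2 := by
  classical
  by_cases hL : L = []
  · subst hL
    obtain ⟨m, hm⟩ := (U.toFinset.image Prod.snd).bddBelow
    refine ⟨m - 1, by simp, fun u hu => Cmp.rel_of_lt ?_⟩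
    have : m ≤ u.2 := hm (by simpa using ⟨u.1, hu⟩)
    linarith
  by_cases hU : U = []
  · subst hU
    obtain ⟨m, hm⟩ := (L.toFinset.image Prod.snd).bddAbove
    refine ⟨m + 1, fun u hu => Cmp.rel_of_lt ?_, by simp⟩
    have : u.2 ≤ m := hm (by simpa using ⟨u.1, hu⟩)
    linarith
  obtain ⟨l, hl, hlmax⟩ := L.toFinset.exists_max_image Prod.snd (by simpa using hL)
  obtain ⟨u, hu, humin⟩ := U.toFinset.exists_min_image Prod.snd (by simpa using hU)
  simp only [List.mem_toFinset] at hl hlmax hu humin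
  have hlu := (h l hl u hu).le
  rcases hlu.lt_or_eq with hlt | heq
  · refine ⟨(l.2 + u.2) / 2, fun l' hl' => Cmp.rel_of_lt ?_, fun u' hu' => Cmp.rel_of_lt ?_⟩
    · have := hlmax l' hl'; linarith
    · have := humin u' hu'; linarith
  -- The greatest lower bound meets the least upper bound, so their common value is the only
  -- candidate. Any bound attained there must be non-strict, since the stricter symbol of the pair
  -- relates this value to itself.
  · refine ⟨l.2, fun l' hl' => ?_, fun u' hu' => ?_⟩
    · rcases (hlmax l' hl').lt_or_eq with h1 | h1
      · exact Cmp.rel_of_lt h1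
      · have := h l' hl' u hu
        rw [h1, ← heq] at this
        rw [h1]
        exact (Cmp.rel_of_strictest_self this).1
    · rcases (humin u' hu').lt_or_eq with h1 | h1
      · exact Cmp.rel_of_lt (heq ▸ h1)
      · have := h l hl u' hu'
        rw [← h1, ← heq] at this
        rw [← h1, ← heq]
        exact (Cmp.rel_of_strictest_self this).2

/-- Elimination of a variable from a finite conjunction of difference constraints. -/
theorem exists_eliminate {Y : Type*} [DecidableEq Y] (C : List (Diff Y)) (y : Y) :
    ∃ C' : List (Diff Y), ∀ u : Y → ℝ,
      (∀ φ ∈ C', φ.Sat u) ↔ ∃ r : ℝ, ∀ φ ∈ C, φ.Sat (Function.update u y r) := by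
  set L := C.filter fun φ => φ.b = y ∧ φ.a ≠ y with hL
  set U := C.filter fun φ => φ.a = y ∧ φ.b ≠ y with hU
  -- If `y` occurs on both sides of the difference it cancels, so these constraints do not depend on
  -- its value.
  set N := C.filter fun φ => (φ.a = y ↔ φ.b = y) with hN
  -- Fourier–Motzkin: adding `l.a - y ◁ l.c` and `y - k.b ◁ k.c` removes `y`.
  refine ⟨N ++ L.flatMap fun l => U.map fun k => ⟨l.a, k.b, l.s.strictest k.s, l.c + k.c⟩, ?_⟩
  intro u
  have hsatN : ∀ φ ∈ N, ∀ r, φ.Sat (Function.update u y r) ↔ φ.Sat u := by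
    intro φ hφ r
    simp only [hN, List.mem_filter, decide_eq_true_eq] at hφ
    by_cases ha : φ.a = y
    · have hb := hφ.2.1 ha
      simp [Diff.Sat, ha, hb]
    · have hb : φ.b ≠ y := fun hb => ha (hφ.2.2 hb)
      simp [Diff.Sat, ha, hb]
  have hsatL : ∀ φ ∈ L, ∀ r, φ.Sat (Function.update u y r) ↔ φ.s.Rel (u φ.a - φ.c) r := by
    intro φ hφ r
    simp only [hL, List.mem_filter, decide_eq_true_eq] at hφ
    obtain ⟨-, hb, ha⟩ := hφ
    rw [Diff.Sat, hb, Function.update_self, Function.update_of_ne ha]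
    exact Cmp.rel_iff_of_sub_eq (by ring)
  have hsatU : ∀ φ ∈ U, ∀ r, φ.Sat (Function.update u y r) ↔ φ.s.Rel r (u φ.b + φ.c) := by
    intro φ hφ r
    simp only [hU, List.mem_filter, decide_eq_true_eq] at hφ
    obtain ⟨-, ha, hb⟩ := hφ
    rw [Diff.Sat, ha, Function.update_self, Function.update_of_ne hb]
    exact Cmp.rel_iff_of_sub_eq (by ring)
  have hsplit : ∀ φ ∈ C, φ ∈ N ∨ φ ∈ L ∨ φ ∈ U := by
    intro φ hφ
    simp only [hL, hU, hN, List.mem_filter, decide_eq_true_eq, hφ, true_and]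
    tauto
  have hpair : ∀ l k : Diff Y,
      Diff.Sat u ⟨l.a, k.b, l.s.strictest k.s, l.c + k.c⟩ ↔
        (l.s.strictest k.s).Rel (u l.a - l.c) (u k.b + k.c) := by
    intro l k
    refine Cmp.rel_iff_of_sub_eq ?_
    push_cast
    ring
  constructor
  · intro h
    obtain ⟨r, hr1, hr2⟩ := exists_between_bounds (L.map fun l => (l.s, u l.a - l.c))
      (U.map fun k => (k.s, u k.b + k.c)) (by
        intro l hl k hk
        obtain ⟨l, hl', rfl⟩ := List.mem_map.1 hl
        obtain ⟨k, hk', rfl⟩ := List.mem_map.1 hk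
        refine (hpair l k).1 (h _ (List.mem_append_right _ ?_))
        exact List.mem_flatMap.2 ⟨l, hl', List.mem_map.2 ⟨k, hk', rfl⟩⟩)
    refine ⟨r, fun φ hφ => ?_⟩
    rcases hsplit φ hφ with h1 | h1 | h1
    · exact (hsatN φ h1 r).2 (h φ (List.mem_append_left _ h1))
    · exact (hsatL φ h1 r).2 (hr1 _ (List.mem_map.2 ⟨φ, h1, rfl⟩))
    · exact (hsatU φ h1 r).2 (hr2 _ (List.mem_map.2 ⟨φ, h1, rfl⟩))
  · rintro ⟨r, hr⟩ φ hφ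
    rcases List.mem_append.1 hφ with h1 | h1
    · exact (hsatN φ h1 r).1 (hr φ (List.mem_of_mem_filter h1))
    · obtain ⟨l, hl, h2⟩ := List.mem_flatMap.1 h1
      obtain ⟨k, hk, rfl⟩ := List.mem_map.1 h2
      exact (hpair l k).2 (((hsatL l hl r).1 (hr l (List.mem_of_mem_filter hl))).strictest_trans
        ((hsatU k hk r).1 (hr k (List.mem_of_mem_filter hk))))

/-! ### Closure of zones under guards, time elapse and resets -/

variable {Q X : Type*}

/-- The values of the variables `Option X`, where `none` stands for the constant `0`. -/
def Valuation.ext (v : Valuation X) : Option X → ℝ := fun o => o.elim 0 fun x => (v x : ℝ)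

@[simp] theorem Valuation.ext_none (v : Valuation X) : v.ext none = 0 := rfl

@[simp] theorem Valuation.ext_some (v : Valuation X) (x : X) : v.ext (some x) = v x := rfl

/-- Sets of valuations given by finitely many difference constraints over the clocks and `0`. -/
def IsDiffZone (Z : Set (Valuation X)) : Prop :=
  ∃ C : List (Diff (Option X)), ∀ v, v ∈ Z ↔ ∀ φ ∈ C, φ.Sat v.ext

/-- A difference constraint over the clocks and `0`, as zone constraints. -/
def Diff.toZone : Diff (Option X) → List (ZoneConstraint X)
  | ⟨none, none, _, _⟩ => []
  | ⟨some x, none, s, c⟩ => [.upper x s c]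
  | ⟨none, some y, s, c⟩ => [.lower s (-c) y]
  | ⟨some x, some y, s, c⟩ => [.diag x y s c]

/-- `Diff.toZone` drops the constraints `0 - 0 ◁ c`, which is harmless because a point of `Z`
witnesses their truth. Nonemptiness cannot be dispensed with: over no clocks, the empty set is not a
zone. -/
theorem IsDiffZone.isZone {Z : Set (Valuation X)} (h : IsDiffZone Z) (hne : Z.Nonempty) :
    IsZone Z := by
  obtain ⟨C, hC⟩ := h
  obtain ⟨v₀, hv₀⟩ := hne
  have hsat : ∀ φ ∈ C, ∀ v : Valuation X, φ.Sat v.ext ↔ ∀ ψ ∈ φ.toZone, ψ.Sat v := by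
    rintro ⟨_ | x, _ | y, s, c⟩ hφ v
    · have := (hC v₀).1 hv₀ _ hφ
      simpa [Diff.toZone, Diff.Sat] using this
    · simp only [Diff.toZone, Diff.Sat, List.mem_singleton, forall_eq, ZoneConstraint.Sat,
        Valuation.ext_none, Valuation.ext_some]
      exact Cmp.rel_iff_of_sub_eq (by push_cast; ring)
    · simp [Diff.toZone, Diff.Sat, ZoneConstraint.Sat]
    · simp [Diff.toZone, Diff.Sat, ZoneConstraint.Sat]
  refine ⟨C.flatMap Diff.toZone, Set.ext fun v => ?_⟩
  rw [hC]
  constructor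
  · intro h ψ hψ
    obtain ⟨φ, hφ, hψ⟩ := List.mem_flatMap.1 hψ
    exact (hsat φ hφ v).1 (h φ hφ) ψ hψ
  · intro h φ hφ
    exact (hsat φ hφ v).2 fun ψ hψ => h ψ (List.mem_flatMap.2 ⟨φ, hφ, hψ⟩)

theorem IsDiffZone.inter {Z Z' : Set (Valuation X)} (h : IsDiffZone Z) (h' : IsDiffZone Z') :
    IsDiffZone (Z ∩ Z') := by
  obtain ⟨C, hC⟩ := h
  obtain ⟨C', hC'⟩ := h'
  refine ⟨C ++ C', fun v => ?_⟩
  rw [List.forall_mem_append, ← hC, ← hC']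
  rfl

/-- An atomic constraint as a difference constraint. -/
def Constraint.toDiff : Constraint X → Diff (Option X)
  | .upper x s c => ⟨some x, none, s, c⟩
  | .lower s c x => ⟨none, some x, s, -c⟩
  | .diag x y s d => ⟨some x, some y, s, d⟩

theorem Constraint.sat_toDiff (φ : Constraint X) (v : Valuation X) :
    φ.toDiff.Sat v.ext ↔ φ.Sat v := by
  cases φ with
  | upper x s c => simp [toDiff, Diff.Sat, Sat]
  | lower s c x =>
    simp only [toDiff, Diff.Sat, Sat, Valuation.ext_none, Valuation.ext_some]
    exact Cmp.rel_iff_of_sub_eq (by push_cast; ring)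
  | diag x y s d => simp [toDiff, Diff.Sat, Sat]

theorem IsDiffZone.meetGuard {Z : Set (Valuation X)} (h : IsDiffZone Z) (g : Guard X) :
    IsDiffZone (meetGuard Z g) := by
  refine h.inter (Z' := {v | g.Sat v}) ⟨g.toList.map Constraint.toDiff, fun v => ?_⟩
  simp [Guard.Sat, Constraint.sat_toDiff]

theorem IsDiffZone.elapse [Fintype X] {Z : Set (Valuation X)} (h : IsDiffZone Z) :
    IsDiffZone (elapse Z) := by
  classical
  obtain ⟨C, hC⟩ := h
  -- The new variable `some none` holds the delay; it takes the place of `0` in the constraints.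
  obtain ⟨C', hC'⟩ := exists_eliminate
    ((⟨none, some none, .le, 0⟩ : Diff (Option (Option X))) ::
      (Finset.univ.toList.map fun x => ⟨some none, some (some x), .le, 0⟩) ++
        C.map (Diff.map some)) (some none)
  -- The eliminated variable may still occur in `C'`, but its value is immaterial there;
  -- `Option.join` sends it to the constant `0`.
  refine ⟨C'.map (Diff.map Option.join), fun w => ?_⟩
  have hback : (∀ φ ∈ C'.map (Diff.map Option.join), φ.Sat w.ext) ↔
      ∀ φ ∈ C', φ.Sat (w.ext ∘ Option.join) := by
    simp [Diff.sat_map]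
  have hshift : ∀ (v : Valuation X) (δ : ℝ≥0) (φ : Diff (Option X)),
      (φ.map some).Sat
        (Function.update ((v.delay δ).ext ∘ Option.join) (some none) (δ : ℝ)) ↔ φ.Sat v.ext := by
    rintro v δ ⟨_ | x, _ | y, s, c⟩ <;>
      simp [Diff.map, Diff.Sat, Valuation.delay]
  rw [hback, hC']
  constructor
  · rintro ⟨v, hv, δ, rfl⟩
    refine ⟨δ, ?_⟩
    simp only [List.cons_append, List.forall_mem_cons, List.forall_mem_append, List.forall_mem_map]
    refine ⟨by simp [Diff.Sat, Cmp.Rel], fun x _ => ?_, fun φ hφ => ?_⟩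
    · simp [Diff.Sat, Cmp.Rel, Valuation.delay]
    · exact (hshift v δ φ).2 ((hC v).1 hv φ hφ)
  · rintro ⟨r, hr⟩
    simp only [List.cons_append, List.forall_mem_cons, List.forall_mem_append,
      List.forall_mem_map] at hr
    obtain ⟨hr0, hrw, hrC⟩ := hr
    have hr0 : 0 ≤ r := by simpa [Diff.Sat, Cmp.Rel] using hr0
    lift r to ℝ≥0 using hr0
    have hrw : ∀ x, r ≤ w x := fun x => by
      simpa [Diff.Sat, Cmp.Rel] using hrw x (by simp)
    have hw : w = Valuation.delay (fun x => w x - r) r :=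
      funext fun x => (tsub_add_cancel_of_le (hrw x)).symm
    refine ⟨fun x => w x - r, (hC _).2 fun φ hφ => ?_, r, hw⟩
    rw [hw] at hrC
    exact (hshift _ r φ).1 (hrC φ hφ)

theorem IsDiffZone.resetSet_singleton [DecidableEq X] {Z : Set (Valuation X)} (h : IsDiffZone Z)
    (x : X) : IsDiffZone (resetSet {x} Z) := by
  obtain ⟨C, hC⟩ := h
  -- The old value of `x` is forgotten by elimination. The added constraint keeps it nonnegative,
  -- since elimination ranges over all reals.
  obtain ⟨C', hC'⟩ := exists_eliminate (⟨none, some x, .le, 0⟩ :: C) (some x)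
  refine ⟨⟨some x, none, .le, 0⟩ :: C', fun w => ?_⟩
  have hupd : ∀ r : ℝ≥0, Function.update w.ext (some x) (r : ℝ) =
      Valuation.ext (Function.update w x r) := by
    intro r
    funext o
    rcases o with _ | y
    · simp
    · by_cases hy : y = x
      · subst hy; simp
      · simp [hy]
  rw [List.forall_mem_cons, hC']
  constructor
  · rintro ⟨v, hv, rfl⟩
    refine ⟨by simp [Diff.Sat, Cmp.Rel, Valuation.reset], (v x : ℝ), ?_⟩
    have hback : Function.update (v.reset {x}) x (v x) = v := by
      funext y
      by_cases hy : y = x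
      · subst hy; simp
      · simp [hy, Valuation.reset]
    rw [hupd, hback, List.forall_mem_cons]
    exact ⟨by simp [Diff.Sat, Cmp.Rel], (hC v).1 hv⟩
  · rintro ⟨h0, r, hr⟩
    rw [List.forall_mem_cons] at hr
    have hr0 : 0 ≤ r := by simpa [Diff.Sat, Cmp.Rel] using hr.1
    lift r to ℝ≥0 using hr0
    rw [hupd] at hr
    refine ⟨_, (hC _).2 hr.2, ?_⟩
    have hx0 : w x = 0 := by simpa [Diff.Sat, Cmp.Rel, coe_le_zero_iff] using h0
    funext y
    by_cases hy : y = x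
    · subst hy; simp [Valuation.reset, hx0]
    · simp [hy, Valuation.reset]

theorem reset_empty [DecidableEq X] (v : Valuation X) : v.reset ∅ = v :=
  funext fun _ => if_neg (Finset.notMem_empty _)

theorem IsDiffZone.resetSet [DecidableEq X] {Z : Set (Valuation X)} (h : IsDiffZone Z)
    (R : Finset X) : IsDiffZone (resetSet R Z) := by
  induction R using Finset.induction_on with
  | empty =>
    have hid : TimedAutomata.resetSet ∅ Z = Z := by
      ext w
      simp [TimedAutomata.resetSet, reset_empty]
    rwa [hid]
  | insert x R _ ih =>
    have hcomp : ∀ v : Valuation X, v.reset (insert x R) = (v.reset R).reset {x} := by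
      intro v
      funext y
      by_cases hy : y = x <;> simp [Valuation.reset, hy]
    have hset : TimedAutomata.resetSet (insert x R) Z =
        TimedAutomata.resetSet {x} (TimedAutomata.resetSet R Z) := by
      ext w
      constructor
      · rintro ⟨v, hv, rfl⟩
        exact ⟨_, ⟨v, hv, rfl⟩, hcomp v⟩
      · rintro ⟨_, ⟨v, hv, rfl⟩, rfl⟩
        exact ⟨v, hv, (hcomp v).symm⟩
    rw [hset]
    exact ih.resetSet_singleton x

theorem IsDiffZone.post [Fintype X] [DecidableEq X] {Z : Set (Valuation X)} (h : IsDiffZone Z)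
    (t : Transition Q X) : IsDiffZone (t.post Z) :=
  ((h.meetGuard t.guard).resetSet t.reset).elapse

theorem isDiffZone_initialZone [Fintype X] : IsDiffZone (initialZone X) := by
  refine IsDiffZone.elapse ⟨Finset.univ.toList.map fun x => ⟨some x, none, .le, 0⟩, fun v => ?_⟩
  simp [Diff.Sat, Cmp.Rel, funext_iff, coe_le_zero_iff]

end Zones

/-! ### The simulation relation: preorder, guards, delays and resets -/

section Simulation

variable {Q X : Type*} {G : Set (Constraint X)}

theorem sSup_lt_coe_iff {S : Set EReal} (hS : S.Finite) (r : ℝ) :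
    sSup S < (r : EReal) ↔ ∀ a ∈ S, a < (r : EReal) := by
  rcases S.eq_empty_or_nonempty with rfl | hne
  · simp
  · exact hS.csSup_lt_iff hne

theorem lowerBound_lt_iff (hG : G.Finite) (x : X) (r : ℝ) :
    lowerBound G x < (r : EReal) ↔ ∀ s c, Constraint.lower s c x ∈ G → (c : ℝ) < r := by
  have hfin : {r : EReal | ∃ (s : Cmp) (c : ℕ), Constraint.lower s c x ∈ G ∧
      r = ((c : ℝ) : EReal)}.Finite := by
    refine (hG.image fun φ => match φ with
      | .lower _ c _ => ((c : ℝ) : EReal)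
      | _ => 0).subset ?_
    rintro _ ⟨s, c, h, rfl⟩
    exact ⟨_, h, rfl⟩
  rw [lowerBound, sSup_lt_coe_iff hfin]
  constructor
  · exact fun h s c hc => EReal.coe_lt_coe_iff.1 (h _ ⟨s, c, hc, rfl⟩)
  · rintro h _ ⟨s, c, hc, rfl⟩
    exact EReal.coe_lt_coe_iff.2 (h s c hc)

theorem upperBound_lt_iff (hG : G.Finite) (x : X) (r : ℝ) :
    upperBound G x < (r : EReal) ↔ ∀ s c, Constraint.upper x s c ∈ G → (c : ℝ) < r := by
  have hfin : {r : EReal | ∃ (s : Cmp) (c : ℕ), Constraint.upper x s c ∈ G ∧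
      r = ((c : ℝ) : EReal)}.Finite := by
    refine (hG.image fun φ => match φ with
      | .upper _ _ c => ((c : ℝ) : EReal)
      | _ => 0).subset ?_
    rintro _ ⟨s, c, h, rfl⟩
    exact ⟨_, h, rfl⟩
  rw [upperBound, sSup_lt_coe_iff hfin]
  constructor
  · exact fun h s c hc => EReal.coe_lt_coe_iff.1 (h _ ⟨s, c, hc, rfl⟩)
  · rintro h _ ⟨s, c, hc, rfl⟩
    exact EReal.coe_lt_coe_iff.2 (h s c hc)

/-- For a finite set of constraints, the bounds in `GuardLUSim` may be replaced by the constants of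
the individual constraints. -/
theorem guardLUSim_iff (hG : G.Finite) {v v' : Valuation X} :
    GuardLUSim G v v' ↔
      (∀ x, v' x < v x → ∀ s c, Constraint.lower s c x ∈ G → (c : ℝ) < v' x) ∧
      (∀ x, v x < v' x → ∀ s c, Constraint.upper x s c ∈ G → (c : ℝ) < v x) ∧
      ∀ x y s d, Constraint.diag x y s d ∈ G → (Constraint.diag x y s d).Sat v →
        (Constraint.diag x y s d).Sat v' := by
  simp only [GuardLUSim, LUSim, lowerBound_lt_iff hG, upperBound_lt_iff hG, forall_and, and_assoc]
  refine and_congr_right fun _ => and_congr_right fun _ => ⟨?_, ?_⟩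
  · exact fun h x y s d hφ => h _ hφ trivial
  · rintro h (_ | _ | ⟨x, y, s, d⟩) hφ hd
    · exact hd.elim
    · exact hd.elim
    · exact h x y s d hφ

theorem GuardLUSim.refl (G : Set (Constraint X)) (v : Valuation X) : GuardLUSim G v v :=
  ⟨fun _ => ⟨fun h => (lt_irrefl _ h).elim, fun h => (lt_irrefl _ h).elim⟩, fun _ _ _ h => h⟩

/-- If a clock goes down overall, either the second step lowers it and gives the bound at once, or
the first step lowers it to `v'` and the bound passes up to `v''`. Upwards the steps swap roles. -/
theorem GuardLUSim.trans {v v' v'' : Valuation X} (h : GuardLUSim G v v')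
    (h' : GuardLUSim G v' v'') : GuardLUSim G v v'' := by
  refine ⟨fun x => ⟨fun hx => ?_, fun hx => ?_⟩, fun φ hφ hd hv => h'.2 φ hφ hd (h.2 φ hφ hd hv)⟩
  · rcases lt_or_ge (v'' x) (v' x) with h1 | h1
    · exact (h'.1 x).1 h1
    · refine ((h.1 x).1 (h1.trans_lt hx)).trans_le ?_
      exact EReal.coe_le_coe_iff.2 (NNReal.coe_le_coe.2 h1)
  · rcases lt_or_ge (v x) (v' x) with h1 | h1
    · exact (h.1 x).2 h1
    · refine ((h'.1 x).2 (h1.trans_lt hx)).trans_le ?_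
      exact EReal.coe_le_coe_iff.2 (NNReal.coe_le_coe.2 h1)

theorem GuardLUSim.sat (hG : G.Finite) {v v' : Valuation X} (h : GuardLUSim G v v')
    {φ : Constraint X} (hφ : φ ∈ G) (hv : φ.Sat v) : φ.Sat v' := by
  obtain ⟨hL, hU, hD⟩ := (guardLUSim_iff hG).1 h
  cases φ with
  | upper x s c =>
    have hle : (v x : ℝ) ≤ c := Cmp.Rel.le hv
    have hx : (v' x : ℝ) ≤ v x := by
      rw [NNReal.coe_le_coe]
      by_contra! hx
      exact (hU x hx s c hφ).not_ge hle
    cases s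
    · exact lt_of_le_of_lt hx hv
    · exact hx.trans hv
  | lower s c x =>
    rcases lt_or_ge (v' x) (v x) with hx | hx
    · exact Cmp.rel_of_lt (hL x hx s c hφ)
    · have hx : (v x : ℝ) ≤ v' x := NNReal.coe_le_coe.2 hx
      cases s
      · exact lt_of_lt_of_le hv hx
      · exact le_trans hv hx
  | diag x y s d => exact hD x y s d hφ hv

theorem GuardLUSim.delay (hG : G.Finite) {v v' : Valuation X} (h : GuardLUSim G v v') (δ : ℝ≥0) :
    GuardLUSim G (v.delay δ) (v'.delay δ) := by
  obtain ⟨hL, hU, hD⟩ := (guardLUSim_iff hG).1 h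
  refine (guardLUSim_iff hG).2 ⟨fun x hx s c hc => ?_, fun x hx s c hc => ?_,
    fun x y s d hφ hv => ?_⟩
  · refine (hL x (lt_of_add_lt_add_right hx) s c hc).trans_le ?_
    exact NNReal.coe_le_coe.2 le_self_add
  · refine (hU x (lt_of_add_lt_add_right hx) s c hc).trans_le ?_
    exact NNReal.coe_le_coe.2 le_self_add
  · have hdelay : ∀ w : Valuation X, (Constraint.diag x y s d).Sat (w.delay δ) ↔
        (Constraint.diag x y s d).Sat w := fun w =>
      Cmp.rel_iff_of_sub_eq (by simp only [Valuation.delay]; push_cast; ring)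
    exact (hdelay v').2 (hD x y s d hφ ((hdelay v).1 hv))

/-- If the weakest preconditions of the constraints in `G'` belong to `G`, then the simulation
for `G` becomes the simulation for `G'` after the reset. -/
theorem GuardLUSim.reset [DecidableEq X] {G' : Set (Constraint X)} (hG : G.Finite)
    (hG' : G'.Finite) {R : Finset X} (hwp : ∀ ψ ∈ G', ∀ φ ∈ ψ.wp R, φ ∈ G) {v v' : Valuation X}
    (h : GuardLUSim G v v') : GuardLUSim G' (v.reset R) (v'.reset R) := by
  obtain ⟨hL, hU, hD⟩ := (guardLUSim_iff hG).1 h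
  refine (guardLUSim_iff hG').2 ⟨fun x hx s c hc => ?_, fun x hx s c hc => ?_,
    fun x y s d hφ hv => ?_⟩
  · by_cases hxR : x ∈ R
    · simp [Valuation.reset, hxR] at hx
    · simp only [Valuation.reset, hxR, if_false] at hx ⊢
      exact hL x hx s c (hwp _ hc _ (by simp [Constraint.wp, hxR]))
  · by_cases hxR : x ∈ R
    · simp [Valuation.reset, hxR] at hx
    · simp only [Valuation.reset, hxR, if_false] at hx ⊢
      exact hU x hx s c (hwp _ hc _ (by simp [Constraint.wp, hxR]))
  · by_cases hx : x ∈ R <;> by_cases hy : y ∈ R <;>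
      simp only [Constraint.Sat, Valuation.reset, hx, hy, if_true, if_false] at hv ⊢
    · exact hv
    · simp only [NNReal.coe_zero, zero_sub] at hv ⊢
      -- The constraint has become `-y ◁ d`. For `d ≤ 0` it is the lower bound supplied by `wp`; for
      -- `d > 0` it always holds, so `wp` may omit it.
      by_cases hd : 0 ≤ -d
      · have hmem := hwp _ hφ (.lower s (-d).toNat y)
          (by simp [Constraint.wp, hx, hy, Int.neg_nonneg.1 hd])
        have hcast : (((-d).toNat : ℕ) : ℝ) = -d := by
          exact_mod_cast congrArg (Int.cast : ℤ → ℝ) (Int.toNat_of_nonneg hd)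
        have hiff : ∀ w : Valuation X, (Constraint.lower s (-d).toNat y).Sat w ↔
            s.Rel (-(w y : ℝ)) d := fun w => by
          simp only [Constraint.Sat, hcast]
          exact Cmp.rel_iff_of_sub_eq (by ring)
        exact (hiff v').1 (h.sat hG hmem ((hiff v).2 hv))
      · have hd : (0 : ℝ) < d := by exact_mod_cast (by omega : 0 < d)
        exact Cmp.rel_of_lt (by have := (v' y).coe_nonneg; linarith)
    · simp only [NNReal.coe_zero, sub_zero] at hv ⊢
      -- A negative `d` would make `x ◁ d` false, against `hv`; this is the case where `wp` is
      -- empty.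
      have hd : 0 ≤ d := by
        exact_mod_cast (v x).coe_nonneg.trans hv.le
      have hmem := hwp _ hφ (.upper x s d.toNat) (by simp [Constraint.wp, hx, hy, hd])
      have hcast : ((d.toNat : ℕ) : ℝ) = d := by
        exact_mod_cast congrArg (Int.cast : ℤ → ℝ) (Int.toNat_of_nonneg hd)
      have hiff : ∀ w : Valuation X, (Constraint.upper x s d.toNat).Sat w ↔
          s.Rel (w x : ℝ) d := fun w => by
        simp only [Constraint.Sat, hcast]
      exact (hiff v').1 (h.sat hG hmem ((hiff v).2 hv))
    · refine hD x y s d (hwp _ hφ _ ?_) hv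
      simp [Constraint.wp, hx, hy]

end Simulation

/-! ### Retimings, bounded representatives and finitely many codes -/

section Finiteness

/-- Strictly increasing maps of the line that fix `0` and commute with the translation by `1`. -/
structure Retiming (ρ : ℝ → ℝ) : Prop where
  strictMono : StrictMono ρ
  map_zero : ρ 0 = 0
  map_add_one : ∀ t, ρ (t + 1) = ρ t + 1

namespace Retiming

variable {ρ : ℝ → ℝ} (hρ : Retiming ρ)

include hρ

theorem map_add_int (t : ℝ) (z : ℤ) : ρ (t + z) = ρ t + z := by
  induction z using Int.induction_on with
  | zero => simp
  | succ n ih =>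
    push_cast at ih ⊢
    rw [← add_assoc, hρ.map_add_one, ih, add_assoc]
  | pred n ih =>
    have := hρ.map_add_one (t + ((-(n : ℤ) - 1 : ℤ) : ℝ))
    push_cast at this ih ⊢
    rw [show t + (-(n : ℝ) - 1) + 1 = t + -n by ring, ih] at this
    linarith

theorem map_int (z : ℤ) : ρ z = z := by
  have := hρ.map_add_int 0 z
  rwa [zero_add, hρ.map_zero, zero_add] at this

theorem rel_iff (s : Cmp) (a b : ℝ) : s.Rel (ρ a) (ρ b) ↔ s.Rel a b := by
  cases s
  exacts [hρ.strictMono.lt_iff_lt, hρ.strictMono.le_iff_le]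

theorem nonneg {t : ℝ} (ht : 0 ≤ t) : 0 ≤ ρ t := by
  rw [← hρ.map_zero]
  exact hρ.strictMono.monotone ht

/-- Commuting with integer translations turns the left side into a comparison of `ρ a` with `ρ (b +
c)`, and monotonicity removes `ρ`. -/
theorem rel_sub_iff (s : Cmp) (a b : ℝ) (c : ℤ) : s.Rel (ρ a - ρ b) c ↔ s.Rel (a - b) c := by
  have h1 : s.Rel (ρ a - ρ b) c ↔ s.Rel (ρ a) (ρ (b + c)) := by
    rw [hρ.map_add_int]
    exact Cmp.rel_iff_of_sub_eq (by ring)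
  rw [h1, hρ.rel_iff]
  exact Cmp.rel_iff_of_sub_eq (by ring)

end Retiming

variable {X : Type*}

/-- The action of a retiming on valuations. -/
noncomputable def Valuation.retime (ρ : ℝ → ℝ) (v : Valuation X) : Valuation X :=
  fun x => (ρ (v x)).toNNReal

theorem Retiming.coe_retime {ρ : ℝ → ℝ} (hρ : Retiming ρ) (v : Valuation X) (x : X) :
    (v.retime ρ x : ℝ) = ρ (v x) :=
  Real.coe_toNNReal _ (hρ.nonneg (v x).coe_nonneg)

theorem Retiming.retime_lt_iff {ρ : ℝ → ℝ} (hρ : Retiming ρ) (v w : Valuation X) (x : X) :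
    v.retime ρ x < w.retime ρ x ↔ v x < w x := by
  rw [← NNReal.coe_lt_coe, hρ.coe_retime, hρ.coe_retime, hρ.strictMono.lt_iff_lt,
    NNReal.coe_lt_coe]

theorem IsDiffZone.retime_mem {Z : Set (Valuation X)} (hZ : IsDiffZone Z) {ρ : ℝ → ℝ}
    (hρ : Retiming ρ) {v : Valuation X} (hv : v ∈ Z) : v.retime ρ ∈ Z := by
  obtain ⟨C, hC⟩ := hZ
  refine (hC _).2 fun φ hφ => ?_
  have hext : (v.retime ρ).ext = ρ ∘ v.ext := by
    funext o
    cases o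
    · simp [hρ.map_zero]
    · simp [hρ.coe_retime]
  rw [Diff.Sat, hext]
  exact (hρ.rel_sub_iff _ _ _ _).2 ((hC v).1 hv φ hφ)

theorem GuardLUSim.retime {G : Set (Constraint X)} (hG : G.Finite) {ρ : ℝ → ℝ} (hρ : Retiming ρ)
    {v w : Valuation X} (h : GuardLUSim G v w) : GuardLUSim G (v.retime ρ) (w.retime ρ) := by
  obtain ⟨hL, hU, hD⟩ := (guardLUSim_iff hG).1 h
  have hnat : ∀ (u : Valuation X) x (c : ℕ), (c : ℝ) < u x → (c : ℝ) < u.retime ρ x := by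
    intro u x c hc
    rw [hρ.coe_retime]
    have := hρ.map_int c
    rw [Int.cast_natCast] at this
    rw [← this]
    exact hρ.strictMono hc
  refine (guardLUSim_iff hG).2 ⟨fun x hx s c hc => ?_, fun x hx s c hc => ?_,
    fun x y s d hφ hv => ?_⟩
  · exact hnat _ _ _ (hL x ((hρ.retime_lt_iff _ _ _).1 hx) s c hc)
  · exact hnat _ _ _ (hU x ((hρ.retime_lt_iff _ _ _).1 hx) s c hc)
  · have hiff : ∀ u : Valuation X, (Constraint.diag x y s d).Sat (u.retime ρ) ↔
        (Constraint.diag x y s d).Sat u := fun u => by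
      simp only [Constraint.Sat, hρ.coe_retime]
      exact hρ.rel_sub_iff _ _ _ _
    exact (hiff w).2 (hD x y s d hφ ((hiff v).1 hv))

/-- A strictly increasing function on a finite set of reals extends to the line. -/
theorem exists_strictMono_extension (s : Finset ℝ) (h : ℝ → ℝ) (hs : StrictMonoOn h s) :
    ∃ H : ℝ → ℝ, StrictMono H ∧ ∀ t ∈ s, H t = h t := by
  induction s using Finset.induction_on_max with
  | empty => exact ⟨id, strictMono_id, by simp⟩
  | insert a s hmax ih =>
    obtain ⟨H, hH, hHs⟩ := ih (hs.mono (by simp))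
    rcases s.eq_empty_or_nonempty with rfl | hne
    · refine ⟨fun t => t - a + h a, fun t u htu => by simpa using htu, by simp⟩
    set m := s.max' hne
    have hm : m ∈ s := s.max'_mem hne
    have hma : m < a := hmax m hm
    have hhm : h m < h a := hs (by simp [hm]) (by simp) hma
    -- Beyond `m` the extension is affine, with the slope that sends `a` to `h a`.
    set k := (h a - h m) / (a - m)
    have hk : 0 < k := div_pos (by linarith) (by linarith)
    refine ⟨fun t => if t ≤ m then H t else h m + (t - m) * k, fun t u htu => ?_, fun t ht => ?_⟩
    · dsimp only
      split_ifs with h1 h2 h2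
      · exact hH htu
      · have h3 : H t ≤ h m := (hHs m hm) ▸ hH.monotone h1
        have h4 : 0 < (u - m) * k := mul_pos (by linarith) hk
        linarith
      · linarith
      · have h4 : (t - m) * k < (u - m) * k := mul_lt_mul_of_pos_right (by linarith) hk
        linarith
    · rcases Finset.mem_insert.1 ht with rfl | ht
      · have h1 : t - m ≠ 0 := by linarith
        simp only [not_le.2 hma, if_false, k]
        field_simp
        ring
      · simp [s.le_max' t ht, m, hHs t ht]

theorem exists_strictMono_comp_eq {ι : Type*} [Finite ι] (f g : ι → ℝ)
    (h : ∀ i j, f i ≤ f j ↔ g i ≤ g j) : ∃ H : ℝ → ℝ, StrictMono H ∧ ∀ i, H (f i) = g i := by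
  cases nonempty_fintype ι
  have hfac : Function.FactorsThrough g f := fun i j hij =>
    le_antisymm ((h i j).1 hij.le) ((h j i).1 hij.ge)
  obtain ⟨H, hH, hHs⟩ := exists_strictMono_extension (Finset.univ.image f)
    (Function.extend f g 0) (by
      intro a ha b hb hab
      simp only [Finset.coe_image, Finset.coe_univ, Set.image_univ, Set.mem_range] at ha hb
      obtain ⟨i, rfl⟩ := ha
      obtain ⟨j, rfl⟩ := hb
      rw [hfac.extend_apply, hfac.extend_apply]
      exact not_le.1 fun hle => hab.not_ge ((h j i).2 hle))
  exact ⟨H, hH, fun i => by rw [hHs _ (by simp), hfac.extend_apply]⟩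

/-- `H` on the unit interval is repeated periodically; fixing both endpoints keeps consecutive
pieces in increasing order. -/
theorem retiming_of_strictMono {H : ℝ → ℝ} (hH : StrictMono H) (h0 : H 0 = 0) (h1 : H 1 = 1) :
    Retiming fun t => ⌊t⌋ + H (Int.fract t) where
  strictMono := fun s t hst => by
    dsimp only
    rcases (Int.floor_mono hst.le).lt_or_eq with hlt | heq
    · have h2 : H (Int.fract s) < 1 := h1 ▸ hH (Int.fract_lt_one s)
      have h3 : 0 ≤ H (Int.fract t) := h0 ▸ hH.monotone (Int.fract_nonneg t)
      have h4 : (⌊s⌋ : ℝ) + 1 ≤ ⌊t⌋ := by exact_mod_cast hlt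
      linarith
    · rw [heq]
      have : Int.fract s < Int.fract t := by
        simp only [Int.fract, heq]
        linarith
      have := hH this
      linarith
  map_zero := by simp [h0]
  map_add_one := fun t => by
    rw [Int.floor_add_one, Int.fract_add_one]
    push_cast
    ring

/-- The fractional parts of the clocks, and `0`. -/
noncomputable def Valuation.fracs (v : Valuation X) : Option X → ℝ :=
  fun o => o.elim 0 fun x => Int.fract (v x : ℝ)

theorem exists_retiming [Finite X] {v w : Valuation X} (hfl : ∀ x, ⌊(v x : ℝ)⌋ = ⌊(w x : ℝ)⌋)
    (hfr : ∀ i j, v.fracs i ≤ v.fracs j ↔ w.fracs i ≤ w.fracs j) :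
    ∃ ρ, Retiming ρ ∧ v.retime ρ = w := by
  have hlt : ∀ (u : Valuation X) i, u.fracs i < 1 := by
    rintro u (_ | x)
    exacts [zero_lt_one, Int.fract_lt_one _]
  -- The extra index carries the value `1`, and `fracs` already includes `0`, so `H` fixes both.
  obtain ⟨H, hH, hHe⟩ := exists_strictMono_comp_eq
    (fun o : Option (Option X) => o.elim 1 v.fracs) (fun o => o.elim 1 w.fracs) (by
      rintro (_ | i) (_ | j)
      · simp
      · exact iff_of_false (hlt v j).not_ge (hlt w j).not_ge
      · simp [(hlt _ _).le]
      · exact hfr i j)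
  have hρ := retiming_of_strictMono hH (hHe (some none)) (hHe none)
  refine ⟨_, hρ, ?_⟩
  funext x
  rw [← NNReal.coe_inj, hρ.coe_retime]
  have : H (Int.fract (v x : ℝ)) = Int.fract (w x : ℝ) := hHe (some (some x))
  rw [this, hfl, Int.floor_add_fract]

/-- Two valuations agree on all comparisons with constants of absolute value at most `M`, because
clocks and differences of clocks are equal or beyond `M` in the same direction. -/
structure AgreeUpTo (M : ℕ) (v w : Valuation X) : Prop where
  clock : ∀ x, v x = w x ∨ ((M : ℝ) < v x ∧ (M : ℝ) < w x)
  diff : ∀ x y, (v x : ℝ) - v y = w x - w y ∨ ((M : ℝ) < v x - v y ∧ (M : ℝ) < w x - w y) ∨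
    ((v x : ℝ) - v y < -M ∧ (w x : ℝ) - w y < -M)

theorem AgreeUpTo.symm {M : ℕ} {v w : Valuation X} (h : AgreeUpTo M v w) : AgreeUpTo M w v where
  clock := fun x => (h.clock x).imp Eq.symm And.symm
  diff := fun x y => (h.diff x y).imp Eq.symm (Or.imp And.symm And.symm)

theorem AgreeUpTo.guardLUSim {G : Set (Constraint X)} (hG : G.Finite) {M : ℕ}
    (hM : ∀ φ ∈ G, φ.BoundedBy M) {v w : Valuation X} (h : AgreeUpTo M v w) :
    GuardLUSim G v w := by
  refine (guardLUSim_iff hG).2 ⟨fun x hx s c hc => ?_, fun x hx s c hc => ?_,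
    fun x y s d hφ hv => ?_⟩
  · have hcM : (c : ℝ) ≤ M := Nat.cast_le.2 (hM _ hc)
    rcases h.clock x with h1 | h1
    · exact (hx.ne h1.symm).elim
    · exact hcM.trans_lt h1.2
  · have hcM : (c : ℝ) ≤ M := Nat.cast_le.2 (hM _ hc)
    rcases h.clock x with h1 | h1
    · exact (hx.ne h1).elim
    · exact hcM.trans_lt h1.1
  · have hdM : d.natAbs ≤ M := hM _ hφ
    have hd1 : (d : ℝ) ≤ M := by exact_mod_cast (by omega : d ≤ M)
    have hd2 : -(M : ℝ) ≤ d := by exact_mod_cast (by omega : -(M : ℤ) ≤ d)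
    rcases h.diff x y with h1 | h1 | h1
    · simpa only [Constraint.Sat, h1] using hv
    · exact (h1.1.not_ge ((Cmp.Rel.le hv).trans hd1)).elim
    · exact Cmp.rel_of_lt (h1.2.trans_le hd2)

/-- If no clock lies in `(a, a + M + 1]`, the clocks above may be decreased by `1`. -/
theorem agreeUpTo_of_gap {M a : ℕ} {v : Valuation X}
    (hgap : ∀ x, (v x : ℝ) ≤ a ∨ (a : ℝ) + M + 1 < v x) :
    AgreeUpTo M v fun x => if v x ≤ a then v x else v x - 1 := by
  set w : Valuation X := fun x => if v x ≤ a then v x else v x - 1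
  have ha : (0 : ℝ) ≤ a := a.cast_nonneg
  have hM : (0 : ℝ) ≤ M := M.cast_nonneg
  have hw : ∀ x, ((v x : ℝ) ≤ a ∧ (w x : ℝ) = v x) ∨
      ((a : ℝ) + M + 1 < v x ∧ (w x : ℝ) = v x - 1) := by
    intro x
    rcases hgap x with hx | hx
    · have hx' : v x ≤ a := by exact_mod_cast hx
      exact .inl ⟨hx, by simp [w, hx']⟩
    · have hx' : ¬ v x ≤ a := fun h => by
        have : (v x : ℝ) ≤ a := by exact_mod_cast h
        linarith
      have h1 : (1 : ℝ≥0) ≤ v x := by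
        rw [← NNReal.coe_le_coe, NNReal.coe_one]
        linarith
      exact .inr ⟨hx, by simp [w, hx', NNReal.coe_sub h1]⟩
  refine ⟨fun x => ?_, fun x y => ?_⟩
  · rcases hw x with ⟨-, h⟩ | ⟨h, h'⟩
    · exact .inl (NNReal.coe_injective h.symm)
    · exact .inr ⟨by linarith, by rw [h']; linarith⟩
  -- Across the gap clocks differ by more than `M + 1`, hence by more than `M` after the decrease;
  -- on one side of it differences are unchanged.
  · rcases hw x with ⟨hx, hx'⟩ | ⟨hx, hx'⟩ <;> rcases hw y with ⟨hy, hy'⟩ | ⟨hy, hy'⟩ <;>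
      rw [hx', hy']
    · exact .inl rfl
    · exact .inr (.inr ⟨by linarith, by linarith⟩)
    · exact .inr (.inl ⟨by linarith, by linarith⟩)
    · exact .inl (by ring)

/-- The bound below which every valuation has a representative. -/
def capBound (X : Type*) [Fintype X] (M : ℕ) : ℕ := (Fintype.card X + 1) * (M + 1)

theorem exists_gap [Fintype X] (M : ℕ) (v : Valuation X) {x₀ : X}
    (hx₀ : (capBound X M : ℝ) < v x₀) :
    ∃ a : ℕ, (∀ x, (v x : ℝ) ≤ a ∨ (a : ℝ) + M + 1 < v x) ∧ (a : ℝ) < v x₀ := by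
  classical
  have hM : (0 : ℝ) < (M : ℝ) + 1 := by positivity
  -- The ceiling is the index of the interval `((j - 1)(M + 1), j(M + 1)]` containing the clock.
  -- There are `card X + 1` candidate intervals, so one contains no clock.
  obtain ⟨j, hj, hjv⟩ := Finset.exists_mem_notMem_of_card_lt_card
    (s := Finset.univ.image fun x => ⌈(v x : ℝ) / (M + 1)⌉₊)
    (t := Finset.Icc 1 (Fintype.card X + 1)) (by
      rw [Nat.card_Icc, Nat.add_sub_cancel]
      exact Nat.lt_succ_of_le Finset.card_image_le)
  obtain ⟨hj1, hj2⟩ := Finset.mem_Icc.1 hj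
  obtain ⟨i, rfl⟩ : ∃ i, j = i + 1 := ⟨j - 1, by omega⟩
  refine ⟨i * (M + 1), fun x => ?_, ?_⟩
  · have hne : ⌈(v x : ℝ) / (M + 1)⌉₊ ≠ i + 1 := fun h =>
      hjv (Finset.mem_image.2 ⟨x, Finset.mem_univ x, h⟩)
    push_cast
    rcases lt_or_gt_of_ne hne with h | h
    · left
      exact (div_le_iff₀ hM).1 (Nat.ceil_le.1 (Nat.le_of_lt_succ h))
    · right
      have := (lt_div_iff₀ hM).1 (Nat.lt_ceil.1 h)
      push_cast at this
      linarith
  · refine lt_of_le_of_lt ?_ hx₀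
    rw [Nat.cast_le]
    exact Nat.mul_le_mul_right _ (by omega)

/-- A clock above the bound has an empty gap below it. Lowering all clocks above the gap gives
simulation both ways, as `AgreeUpTo` is symmetric, and the sum of integral parts drops. -/
theorem exists_bounded_representative [Fintype X] {G : Set (Constraint X)} (hG : G.Finite) {M : ℕ}
    (hM : ∀ φ ∈ G, φ.BoundedBy M) (v : Valuation X) :
    ∃ w : Valuation X, GuardLUSim G v w ∧ GuardLUSim G w v ∧
      ∀ x, (w x : ℝ) ≤ capBound X M := by
  induction hN : ∑ x, ⌊v x⌋₊ using Nat.strong_induction_on generalizing v with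
  | _ N ih =>
    by_cases hb : ∀ x, (v x : ℝ) ≤ capBound X M
    · exact ⟨v, .refl G v, .refl G v, hb⟩
    push Not at hb
    obtain ⟨x₀, hx₀⟩ := hb
    obtain ⟨a, hgap, ha⟩ := exists_gap M v hx₀
    have hagree := agreeUpTo_of_gap hgap
    have hfloor : ∀ x, v x - 1 ≤ v x := fun x => tsub_le_self
    obtain ⟨w, h1, h2, h3⟩ := ih _ (by
      rw [← hN]
      refine Finset.sum_lt_sum (fun x _ => Nat.floor_mono ?_) ⟨x₀, Finset.mem_univ _, ?_⟩
      · show (if v x ≤ a then v x else v x - 1) ≤ v x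
        split_ifs
        exacts [le_rfl, hfloor x]
      · have hx : ¬ v x₀ ≤ a := fun h => by
          have : (v x₀ : ℝ) ≤ a := by exact_mod_cast h
          linarith
        have h1 : 1 ≤ ⌊v x₀⌋₊ := by
          rw [Nat.one_le_floor_iff, ← NNReal.coe_le_coe, NNReal.coe_one]
          have := (hgap x₀).resolve_left (not_le.2 ha)
          have := a.cast_nonneg (α := ℝ)
          have := M.cast_nonneg (α := ℝ)
          linarith
        simp only [hx, if_false, Nat.floor_sub_one]
        omega) (fun x => if v x ≤ a then v x else v x - 1) rfl
    exact ⟨w, (hagree.guardLUSim hG hM).trans h1, h2.trans (hagree.symm.guardLUSim hG hM), h3⟩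

/-- The integral parts of the clocks (when they are at most `K`) and the order of the fractional
parts. -/
noncomputable def Valuation.code (K : ℕ) (v : Valuation X) :
    (X → Fin (K + 1)) × (Option X → Option X → Prop) :=
  (fun x => Fin.ofNat (K + 1) ⌊v x⌋₊, fun i j => v.fracs i ≤ v.fracs j)

theorem exists_retiming_of_code_eq [Finite X] {K : ℕ} {v w : Valuation X}
    (hv : ∀ x, (v x : ℝ) ≤ K) (hw : ∀ x, (w x : ℝ) ≤ K) (h : v.code K = w.code K) :
    ∃ ρ, Retiming ρ ∧ v.retime ρ = w := by
  have hfloor : ∀ u : Valuation X, (∀ x, (u x : ℝ) ≤ K) →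
      ∀ x, ((Fin.ofNat (K + 1) ⌊u x⌋₊ : ℕ) : ℤ) = ⌊(u x : ℝ)⌋ := by
    intro u hu x
    have h1 : ⌊u x⌋₊ ≤ K := Nat.floor_le_of_le (by exact_mod_cast hu x)
    have h2 : ⌊(u x : ℝ)⌋₊ = ⌊u x⌋₊ := Nonneg.nat_floor_coe (u x)
    -- Thanks to the bound `K`, the reduction modulo `K + 1` in the code loses nothing.
    rw [Fin.val_ofNat, Nat.mod_eq_of_lt (Nat.lt_succ_of_le h1), ← h2,
      Int.natCast_floor_eq_floor (u x).coe_nonneg]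
  obtain ⟨h1, h2⟩ := Prod.ext_iff.1 h
  refine exists_retiming (fun x => ?_) (fun i j => (congrFun (congrFun h2 i) j).to_iff)
  rw [← hfloor v hv, ← hfloor w hw]
  exact congrArg (fun k : Fin (K + 1) => ((k : ℕ) : ℤ)) (congrFun h1 x)

/-- The codes of the bounded valuations that are simulated by a valuation in `Z`. -/
def simCodes (G : Set (Constraint X)) (K : ℕ) (Z : Set (Valuation X)) :
    Set ((X → Fin (K + 1)) × (Option X → Option X → Prop)) :=
  {c | ∃ v : Valuation X, v.code K = c ∧ (∀ x, (v x : ℝ) ≤ K) ∧ ∃ w ∈ Z, GuardLUSim G v w}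

/-- The bounded representative `u` of `v` shares its code with some `u'` simulated by a point `w` of
`Z'`. A retiming that carries `u'` to `u` carries `w` to another point of `Z'`, which simulates `u`
and hence `v`. -/
theorem exists_guardLUSim_of_simCodes_subset [Fintype X] {G : Set (Constraint X)} (hG : G.Finite)
    {M : ℕ} (hM : ∀ φ ∈ G, φ.BoundedBy M) {Z Z' : Set (Valuation X)} (hZ' : IsDiffZone Z')
    (h : simCodes G (capBound X M) Z ⊆ simCodes G (capBound X M) Z') {v : Valuation X}
    (hv : v ∈ Z) : ∃ w ∈ Z', GuardLUSim G v w := by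
  obtain ⟨u, hvu, huv, hu⟩ := exists_bounded_representative hG hM v
  obtain ⟨u', hcode, hu', w, hw, hsim⟩ := h ⟨u, rfl, hu, v, hv, huv⟩
  obtain ⟨ρ, hρ, rfl⟩ := exists_retiming_of_code_eq hu' hu hcode
  exact ⟨w.retime ρ, hZ'.retime_mem hρ hw, hvu.trans (hsim.retime hG hρ)⟩

end Finiteness

/-! ### Invariant, soundness and completeness of the enumeration -/

section Enumeration

variable {Q X : Type*} [DecidableEq X]

/-- What holds for each node that the enumeration stores: it is a nonempty zone, closed under time
elapse, of configurations that are reachable up to a delay, and its state is not accepting. -/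
structure NodeInv (A : Automaton Q X) (m : Node Q X) : Prop where
  zone : IsDiffZone m.2
  nonempty : m.2.Nonempty
  delay_mem : ∀ v ∈ m.2, ∀ δ, v.delay δ ∈ m.2
  reachable : ∀ v ∈ m.2, ∃ w δ, v = w.delay δ ∧
    Relation.ReflTransGen A.DelayAction (A.init, fun _ => 0) (m.1, w)
  notMem_accept : m.1 ∉ A.accept

omit [DecidableEq X] in
theorem delay_delay (v : Valuation X) (δ ε : ℝ≥0) : (v.delay δ).delay ε = v.delay (δ + ε) :=
  funext fun _ => add_assoc _ _ _

omit [DecidableEq X] in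
theorem delay_zero (v : Valuation X) : v.delay 0 = v := funext fun _ => add_zero _

omit [DecidableEq X] in
theorem delay_mem_elapse {Z : Set (Valuation X)} {v : Valuation X} (hv : v ∈ elapse Z) (δ : ℝ≥0) :
    v.delay δ ∈ elapse Z := by
  obtain ⟨w, hw, ε, rfl⟩ := hv
  exact ⟨w, hw, ε + δ, delay_delay w ε δ⟩

theorem nodeInv_initial [Fintype X] {A : Automaton Q X} (h : A.init ∉ A.accept) :
    NodeInv A (A.init, initialZone X) where
  zone := isDiffZone_initialZone
  nonempty := ⟨_, _, rfl, 0, rfl⟩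
  delay_mem := fun _ hv δ => delay_mem_elapse hv δ
  reachable := by
    rintro _ ⟨_, rfl, δ, rfl⟩
    exact ⟨_, δ, rfl, .refl⟩
  notMem_accept := h

/-- The delay present in the stored valuation becomes the delay before the action. The target may be
accepting, so this also yields the accepting run when one is announced. -/
theorem NodeInv.reachable_post {A : Automaton Q X} {m : Node Q X} (hm : NodeInv A m)
    {t : Transition Q X} (ht : t ∈ A.trans) (hsrc : t.src = m.1) {v : Valuation X}
    (hv : v ∈ t.post m.2) : ∃ w δ, v = w.delay δ ∧
      Relation.ReflTransGen A.DelayAction (A.init, fun _ => 0) (t.tgt, w) := by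
  obtain ⟨_, ⟨u, ⟨hu, hg⟩, rfl⟩, δ, rfl⟩ := hv
  obtain ⟨w, ε, rfl, hreach⟩ := hm.reachable u hu
  exact ⟨_, δ, rfl, hreach.tail ⟨ε, t, ht, hsrc, hg, rfl⟩⟩

theorem NodeInv.post [Fintype X] {A : Automaton Q X} {m : Node Q X} (hm : NodeInv A m)
    {t : Transition Q X} (ht : t ∈ A.trans) (hsrc : t.src = m.1) (hne : (t.post m.2).Nonempty)
    (hacc : t.tgt ∉ A.accept) : NodeInv A (t.tgt, t.post m.2) where
  zone := hm.zone.post t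
  nonempty := hne
  delay_mem := fun _ hv δ => delay_mem_elapse hv δ
  reachable := fun _ hv => hm.reachable_post ht hsrc hv
  notMem_accept := hacc

/-- The successor of `m` by `t` is empty or simulated by a node among `N`. -/
def Covered (A : Automaton Q X) (N : List (Node Q X)) (m : Node Q X) (t : Transition Q X) : Prop :=
  (t.post m.2).Nonempty → ∃ m' ∈ N, A.NodeSim (t.tgt, t.post m.2) m'

theorem Covered.mono {A : Automaton Q X} {N N' : List (Node Q X)} (h : ∀ m ∈ N, m ∈ N')
    {m : Node Q X} {t : Transition Q X} (hc : Covered A N m t) : Covered A N' m t :=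
  fun hne => let ⟨m', hm', hs⟩ := hc hne; ⟨m', h m' hm', hs⟩

/-- The invariant of the enumeration. -/
def SearchInv (A : Automaton Q X) : SearchState Q X → Prop
  | .search P W => (∀ m ∈ P ++ W, NodeInv A m) ∧ (A.init, initialZone X) ∈ P ++ W ∧
      ∀ m ∈ P, ∀ t ∈ A.trans, t.src = m.1 → Covered A (P ++ W) m t
  | .expand P W m ts => (∀ m ∈ P ++ W, NodeInv A m) ∧ (A.init, initialZone X) ∈ P ++ W ∧
      m ∈ P ∧ (∀ t ∈ ts, t ∈ A.trans ∧ t.src = m.1) ∧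
      ∀ m' ∈ P, ∀ t ∈ A.trans, t.src = m'.1 → (m' = m ∧ t ∈ ts) ∨ Covered A (P ++ W) m' t
  | .answer b => b = true ↔ A.HasAcceptingRun

theorem configSim_step [DecidableEq Q] [Finite Q] [Finite X] {A : Automaton Q X}
    {t : Transition Q X} (ht : t ∈ A.trans) {v v' : Valuation X}
    (h : GuardLUSim (A.stateGuards t.src) v v') (hg : t.guard.Sat v) :
    t.guard.Sat v' ∧
      GuardLUSim (A.stateGuards t.tgt) (v.reset t.reset) (v'.reset t.reset) :=
  ⟨fun φ hφ => h.sat (stateGuards_finite A _) (guard_subset_stateGuards A ht hφ) (hg φ hφ),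
    h.reset (stateGuards_finite A _) (stateGuards_finite A _)
      fun _ hψ _ hφ => wp_subset_stateGuards A ht hψ hφ⟩

/-- Along a run, each configuration stays simulated by a point of a stored node: the simulating
point copies the step, and coverage moves the result into a stored node. -/
theorem not_hasAcceptingRun_of_covered [DecidableEq Q] [Finite Q] [Finite X] {A : Automaton Q X}
    {P : List (Node Q X)} (hinv : ∀ m ∈ P, NodeInv A m) (hinit : (A.init, initialZone X) ∈ P)
    (hcov : ∀ m ∈ P, ∀ t ∈ A.trans, t.src = m.1 → Covered A P m t) : ¬ A.HasAcceptingRun := by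
  rintro ⟨c, hrun, hacc⟩
  obtain ⟨m, hm, v', -, hq, -⟩ : ∃ m ∈ P, ∃ v' ∈ m.2, A.ConfigSim c (m.1, v') := by
    clear hacc
    induction hrun with
    | refl => exact ⟨_, hinit, _, ⟨_, rfl, 0, (delay_zero _).symm⟩, rfl, .refl _ _⟩
    | @tail c c' _ hstep ih =>
      obtain ⟨m, hm, v', hv', hq, hsim⟩ := ih
      obtain ⟨δ, t, ht, hsrc, hg, rfl⟩ := hstep
      have hsrc : t.src = c.1 := hsrc
      rw [← hsrc] at hsim
      obtain ⟨hg', hsim'⟩ := configSim_step ht (hsim.delay (stateGuards_finite A _) δ) hg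
      -- The delay of the run takes place inside the node, which is closed under time elapse, so
      -- none is needed after the reset.
      have hpost : (v'.delay δ).reset t.reset ∈ t.post m.2 :=
        ⟨_, ⟨_, ⟨(hinv m hm).delay_mem v' hv' δ, hg'⟩, rfl⟩, 0, (delay_zero _).symm⟩
      obtain ⟨m', hm', hq', hcover⟩ := hcov m hm t ht (hsrc.trans hq) ⟨_, hpost⟩
      obtain ⟨w, hw, -, hsim''⟩ := hcover _ hpost
      exact ⟨m', hm', w, hw, hq', hsim'.trans hsim''⟩
  have hq : c.1 = m.1 := hq
  exact (hinv m hm).notMem_accept (hq ▸ hacc)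

theorem searchInv_start [DecidableEq Q] [Fintype X] (A : Automaton Q X) :
    SearchInv A A.searchStart := by
  unfold Automaton.searchStart
  split_ifs with h
  · exact iff_of_true rfl ⟨_, .refl, h⟩
  · exact ⟨by simpa using nodeInv_initial h, by simp, by simp⟩

theorem SearchInv.step [DecidableEq Q] [Finite Q] [Fintype X] {A : Automaton Q X}
    {s s' : SearchState Q X} (hs : SearchInv A s) (h : A.SearchStep s s') : SearchInv A s' := by
  cases h with
  | finish P =>
    obtain ⟨h1, h2, h3⟩ := hs
    rw [List.append_nil] at h1 h2 h3
    exact iff_of_false (by simp) (not_hasAcceptingRun_of_covered h1 h2 h3)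
  | pick P W₁ W₂ m ts hnd hts =>
    obtain ⟨h1, h2, h3⟩ := hs
    have hperm : ∀ m', m' ∈ P ++ (W₁ ++ m :: W₂) ↔ m' ∈ m :: P ++ (W₁ ++ W₂) := by
      intro m'
      simp only [List.mem_append, List.mem_cons]
      tauto
    refine ⟨fun m' hm' => h1 m' ((hperm m').2 hm'), (hperm _).1 h2, List.mem_cons_self,
      fun t ht => (hts t).1 ht, fun m' hm' t ht hsrc => ?_⟩
    rcases List.mem_cons.1 hm' with rfl | hm'
    · exact .inl ⟨rfl, (hts t).2 ⟨ht, hsrc⟩⟩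
    · exact .inr ((h3 m' hm' t ht hsrc).mono fun m' => (hperm m').1)
  | done P W m =>
    obtain ⟨h1, h2, -, -, h5⟩ := hs
    exact ⟨h1, h2, fun m' hm' t ht hsrc =>
      (h5 m' hm' t ht hsrc).resolve_left fun h => List.not_mem_nil h.2⟩
  | empty P W m t ts he =>
    obtain ⟨h1, h2, h3, h4, h5⟩ := hs
    refine ⟨h1, h2, h3, fun t' ht' => h4 t' (List.mem_cons_of_mem _ ht'), ?_⟩
    intro m' hm' t' ht' hsrc
    rcases h5 m' hm' t' ht' hsrc with ⟨rfl, h⟩ | h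
    · rcases List.mem_cons.1 h with rfl | h
      · exact .inr fun hne => (hne.ne_empty he).elim
      · exact .inl ⟨rfl, h⟩
    · exact .inr h
  | found P W m t ts hne hacc =>
    obtain ⟨h1, -, h3, h4, -⟩ := hs
    obtain ⟨v, hv⟩ := hne
    obtain ⟨ht, hsrc⟩ := h4 t List.mem_cons_self
    obtain ⟨w, -, -, hreach⟩ :=
      (h1 m (List.mem_append_left _ h3)).reachable_post ht hsrc hv
    exact iff_of_true rfl ⟨_, hreach, hacc⟩
  | prune P W m t ts hne hacc hsim =>
    obtain ⟨h1, h2, h3, h4, h5⟩ := hs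
    refine ⟨h1, h2, h3, fun t' ht' => h4 t' (List.mem_cons_of_mem _ ht'), ?_⟩
    intro m' hm' t' ht' hsrc
    rcases h5 m' hm' t' ht' hsrc with ⟨rfl, h⟩ | h
    · rcases List.mem_cons.1 h with rfl | h
      · exact .inr fun _ => hsim
      · exact .inl ⟨rfl, h⟩
    · exact .inr h
  | add P W m t ts hne hacc hsim =>
    obtain ⟨h1, h2, h3, h4, h5⟩ := hs
    obtain ⟨ht, hsrc⟩ := h4 t List.mem_cons_self
    have hnew := (h1 m (List.mem_append_left _ h3)).post ht hsrc hne hacc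
    have hmem : ∀ m', m' ∈ P ++ (t.tgt, t.post m.2) :: W ↔
        m' = (t.tgt, t.post m.2) ∨ m' ∈ P ++ W := by
      intro m'
      simp only [List.mem_append, List.mem_cons]
      tauto
    refine ⟨fun m' hm' => ?_, (hmem _).2 (.inr h2), h3,
      fun t' ht' => h4 t' (List.mem_cons_of_mem _ ht'), ?_⟩
    · rcases (hmem m').1 hm' with rfl | h
      exacts [hnew, h1 m' h]
    intro m' hm' t' ht' hsrc'
    rcases h5 m' hm' t' ht' hsrc' with ⟨rfl, h⟩ | h
    · rcases List.mem_cons.1 h with rfl | h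
      -- The added node covers the successor by reflexivity.
      · exact .inr fun _ => ⟨_, (hmem _).2 (.inl rfl), rfl,
          fun v hv => ⟨v, hv, rfl, .refl _ _⟩⟩
      · exact .inl ⟨rfl, h⟩
    · exact .inr (h.mono fun m' hm' => (hmem m').2 (.inr hm'))

theorem searchInv_of_reaches [DecidableEq Q] [Finite Q] [Fintype X] {A : Automaton Q X}
    {s : SearchState Q X} (h : A.SearchReaches s) : SearchInv A s := by
  induction h with
  | refl => exact searchInv_start A
  | tail _ hstep ih => exact ih.step hstep

theorem SearchInv.nodeInv {A : Automaton Q X} {s : SearchState Q X} (h : SearchInv A s) :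
    ∀ m ∈ s.nodes, NodeInv A m := by
  cases s with
  | search P W => exact h.1
  | expand P W m ts => exact h.1
  | answer b => exact fun m hm => (List.not_mem_nil hm).elim

theorem exists_step_or_eq_answer [DecidableEq Q] (A : Automaton Q X) (s : SearchState Q X) :
    (∃ s', A.SearchStep s s') ∨ ∃ b, s = .answer b := by
  rcases s with ⟨P, _ | ⟨m, W⟩⟩ | ⟨P, W, m, _ | ⟨t, ts⟩⟩ | b
  · exact .inl ⟨_, .finish P⟩
  · exact .inl ⟨_, .pick P [] W m (A.trans.filter fun t => t.src = m.1).toList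
      (Finset.nodup_toList _) (by simp)⟩
  · exact .inl ⟨_, .done P W m⟩
  · rcases (t.post m.2).eq_empty_or_nonempty with he | hne
    · exact .inl ⟨_, .empty P W m t ts he⟩
    by_cases hacc : t.tgt ∈ A.accept
    · exact .inl ⟨_, .found P W m t ts hne hacc⟩
    by_cases hsim : ∃ m' ∈ P ++ W, A.NodeSim (t.tgt, t.post m.2) m'
    · exact .inl ⟨_, .prune P W m t ts hne hacc hsim⟩
    · exact .inl ⟨_, .add P W m t ts hne hacc hsim⟩
  · exact .inr ⟨b, rfl⟩

/-! ### Termination by a lexicographic measure -/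

section Termination

variable {A : Automaton Q X}

/-- The state of a node, and the finite information on its zone that decides whether the node is
simulated by another one. -/
def nodeCode (A : Automaton Q X) (K : ℕ) (m : Node Q X) :
    Q × Set ((X → Fin (K + 1)) × (Option X → Option X → Prop)) :=
  (m.1, simCodes (A.stateGuards m.1) K m.2)

theorem nodeSim_of_nodeCode_eq [DecidableEq Q] [Finite Q] [Fintype X] {M : ℕ}
    (hM : ∀ q, ∀ φ ∈ A.stateGuards q, φ.BoundedBy M) {m m' : Node Q X} (hm' : IsDiffZone m'.2)
    (h : nodeCode A (capBound X M) m = nodeCode A (capBound X M) m') : A.NodeSim m m' := by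
  obtain ⟨q, Z⟩ := m
  obtain ⟨q', Z'⟩ := m'
  obtain ⟨h1, h2⟩ := Prod.ext_iff.1 h
  obtain rfl : q = q' := h1
  refine ⟨rfl, fun v hv => ?_⟩
  obtain ⟨w, hw, hsim⟩ := exists_guardLUSim_of_simCodes_subset (stateGuards_finite A q) (hM q) hm'
    (Eq.subset h2) hv
  exact ⟨w, hw, rfl, hsim⟩

/-- The number of codes that no node among `N` has. -/
noncomputable def unseen (A : Automaton Q X) (K : ℕ) (N : List (Node Q X)) : ℕ :=
  {c | ∀ m ∈ N, nodeCode A K m ≠ c}.ncard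

/-- The quantity that decreases along the executions of the enumeration. -/
noncomputable def searchMeasure (A : Automaton Q X) (K : ℕ) : SearchState Q X → ℕ ×ₗ ℕ ×ₗ ℕ
  | .search P W => toLex (unseen A K (P ++ W), toLex (2 * W.length + 1, 0))
  | .expand P W _ ts => toLex (unseen A K (P ++ W), toLex (2 * W.length + 2, ts.length))
  | .answer _ => toLex (0, toLex (0, 0))

theorem unseen_congr (K : ℕ) {N N' : List (Node Q X)} (h : ∀ m, m ∈ N ↔ m ∈ N') :
    unseen A K N = unseen A K N' := by
  simp only [unseen, h]

/-- The code of `n` is unseen by `N` and seen by `N'`. -/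
theorem unseen_lt [Finite Q] [Finite X] (K : ℕ) {N N' : List (Node Q X)} {n : Node Q X}
    (h : ∀ m, m ∈ N' ↔ m = n ∨ m ∈ N) (hn : ∀ m ∈ N, nodeCode A K m ≠ nodeCode A K n) :
    unseen A K N' < unseen A K N := by
  refine Set.ncard_lt_ncard ⟨fun c hc m hm => hc m ((h m).2 (.inr hm)), fun hsub => ?_⟩
    (Set.toFinite _)
  exact hsub hn n ((h n).2 (.inl rfl)) rfl

/-- Adding a node uses up a code: a repeated one would have caused pruning. The weights `2 *
W.length + 1` and `+ 2` make picking a node decrease the measure, by shortening Waiting, and also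
the return to the search; within an expansion the remaining transitions are counted. -/
theorem searchMeasure_lt [DecidableEq Q] [Finite Q] [Fintype X] {M : ℕ}
    (hM : ∀ q, ∀ φ ∈ A.stateGuards q, φ.BoundedBy M) {s s' : SearchState Q X}
    (hs : SearchInv A s) (h : A.SearchStep s s') :
    searchMeasure A (capBound X M) s' < searchMeasure A (capBound X M) s := by
  have hlex : ∀ a a' b b' c c' : ℕ, (a < a' ∨ a = a' ∧ (b < b' ∨ b = b' ∧ c < c')) →
      (toLex (a, toLex (b, c)) : ℕ ×ₗ ℕ ×ₗ ℕ) < toLex (a', toLex (b', c')) := by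
    intro a a' b b' c c' h
    simpa [Prod.Lex.toLex_lt_toLex] using h
  cases h with
  | finish P => exact hlex _ _ _ _ _ _ (by simp; omega)
  | pick P W₁ W₂ m ts hnd hts =>
    refine hlex _ _ _ _ _ _ (.inr ⟨unseen_congr _ fun m' => ?_, .inl ?_⟩)
    · simp only [List.mem_append, List.mem_cons]
      tauto
    · simp only [List.length_append, List.length_cons]
      omega
  | done P W m => exact hlex _ _ _ _ _ _ (.inr ⟨rfl, .inl (by omega)⟩)
  | empty P W m t ts he => exact hlex _ _ _ _ _ _ (.inr ⟨rfl, .inr ⟨rfl, by simp⟩⟩)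
  | found P W m t ts hne hacc => exact hlex _ _ _ _ _ _ (by simp; omega)
  | prune P W m t ts hne hacc hsim => exact hlex _ _ _ _ _ _ (.inr ⟨rfl, .inr ⟨rfl, by simp⟩⟩)
  | add P W m t ts hne hacc hsim =>
    refine hlex _ _ _ _ _ _ (.inl (unseen_lt _ (n := (t.tgt, t.post m.2)) (fun m' => ?_)
      fun m' hm' heq => hsim ⟨m', hm', nodeSim_of_nodeCode_eq hM (hs.1 m' hm').zone heq.symm⟩))
    simp only [List.mem_append, List.mem_cons]
    tauto

theorem exists_boundedBy_stateGuards [DecidableEq Q] [Finite Q] [Finite X] (A : Automaton Q X) :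
    ∃ M, ∀ q, ∀ φ ∈ A.stateGuards q, φ.BoundedBy M := by
  obtain ⟨M, hM⟩ := exists_boundedBy_of_finite (Set.finite_iUnion (stateGuards_finite A))
  exact ⟨M, fun q φ hφ => hM φ (Set.mem_iUnion.2 ⟨q, hφ⟩)⟩

theorem no_infinite_execution [DecidableEq Q] [Finite Q] [Fintype X] (A : Automaton Q X)
    (f : ℕ → SearchState Q X) (h0 : f 0 = A.searchStart) :
    ¬ ∀ n, A.SearchStep (f n) (f (n + 1)) := by
  intro hstep
  obtain ⟨M, hM⟩ := exists_boundedBy_stateGuards A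
  have hinv : ∀ n, SearchInv A (f n) := by
    intro n
    induction n with
    | zero => exact h0 ▸ searchInv_start A
    | succ n ih => exact ih.step (hstep n)
  exact not_strictAnti_of_wellFoundedLT (fun n => searchMeasure A (capBound X M) (f n))
    (strictAnti_nat_of_succ_lt fun n => searchMeasure_lt hM (hinv n) (hstep n))

end Termination

end Enumeration

end TimedAutomata

theorem mainTheorem1 {Q X : Type*} [Fintype Q] [DecidableEq Q] [Fintype X] [DecidableEq X]
    (A : TimedAutomata.Automaton Q X) :
    -- the fixed point computation stops, and when it stops it has computed the state based guards
    ((∃ n, A.guardRound (n + 1) = A.guardRound n) ∧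
      ∀ n, A.guardRound (n + 1) = A.guardRound n →
        ∀ q, (A.guardRound n q : Set (TimedAutomata.Constraint X)) = A.stateGuards q) ∧
    -- the nodes stored by the enumeration are zones
    (∀ s, A.SearchReaches s → ∀ m ∈ s.nodes, TimedAutomata.IsZone m.2) ∧
    -- termination: no execution is infinite, and an execution only stops with an answer
    (∀ f : ℕ → TimedAutomata.SearchState Q X, f 0 = A.searchStart →
      ¬ ∀ n, A.SearchStep (f n) (f (n + 1))) ∧
    (∀ s, A.SearchReaches s → (∀ s', ¬ A.SearchStep s s') → ∃ b, s = .answer b) ∧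
    -- soundness
    (A.SearchReaches (.answer true) → A.HasAcceptingRun) ∧
    -- completeness
    (A.SearchReaches (.answer false) → ¬ A.HasAcceptingRun) := by
  refine ⟨⟨TimedAutomata.exists_guardRound_stable A, fun n hn q =>
    TimedAutomata.guardRound_eq_stateGuards A hn q⟩, fun s hs m hm => ?_,
    TimedAutomata.no_infinite_execution A, fun s _ hend => ?_, fun h => ?_, fun h hrun => ?_⟩
  · have hinv := (TimedAutomata.searchInv_of_reaches hs).nodeInv m hm
    exact hinv.zone.isZone hinv.nonempty
  · exact (TimedAutomata.exists_step_or_eq_answer A s).resolve_left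
      fun ⟨s', h⟩ => hend s' h
  · exact (TimedAutomata.searchInv_of_reaches h).1 rfl
  · exact Bool.false_ne_true ((TimedAutomata.searchInv_of_reaches h).2 hrun)
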